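/- **Theorem (Type safety of ExEff).** Fix a set of operation names $\mathtt{Op}$. All syntax is taken up to renaming of bound variables, and all substitutions are capture-avoiding. *Syntax.* - Skeletons $\tau ::= \varsigma \mid \mathtt{Unit} \mid \tau_1\to\tau_2 \mid \tau_1\Rrightarrow\tau_2 \mid \forall\varsigma.\tau$. - Dirts $\Delta ::= \delta \mid \emptyset \mid \{\mathtt{Op}\}\cup\Delta$, read as sets: order and repetition of operations do not matter. For a finite set $\mathcal O$ of operations, $\Delta\cup\mathcal O$ adds them all to $\Delta$, and $\mathtt{Op}\in\Delta$ means that $\mathtt{Op}$ is one of the operations listed in $\Delta$. - Value types $T ::= \alpha \mid \mathtt{Unit} \mid T\to C \mid C_1\Rrightarrow C_2 \mid \forall\varsigma.T \mid \forall\alpha{:}\tau.T \mid \forall\delta.T \mid \pi\Rightarrow T$; computation types $C ::= T\,!\,\Delta$; simple coercion types $\pi ::= T_1\le T_2 \mid \Delta_1\le\Delta_2$; coercion types $\rho ::= \pi \mid C_1\le C_2$. - Coercions $\gamma ::= \omega \mid \langle\mathtt{Unit}\rangle \mid \langle\alpha\rangle \mid \langle\Delta\rangle \mid \gamma_1\to\gamma_2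 \mid \gamma_1\Rrightarrow\gamma_2 \mid \emptyset_\Delta \mid \{\mathtt{Op}\}\cup\gamma \mid \forall\varsigma.\gamma \mid \forall(\alpha{:}\tau).\gamma \mid \forall\delta.\gamma \mid \pi\Rightarrow\gamma \mid \gamma_1\,!\,\gamma_2$. - Values $v ::= x \mid \mathtt{unit} \mid \mathtt{fun}\,(x{:}T)\mapsto c \mid h \mid \Lambda\varsigma.v \mid v\,\tau \mid \Lambda\alpha{:}\tau.v \mid v\,T \mid \Lambda\delta.v \mid v\,\Delta \mid \Lambda(\omega{:}\pi).v \mid v\,\gamma \mid v\rhd\gamma$, with handlers $h=\{\mathtt{return}\,(x{:}T)\mapsto c_r,\ [\mathtt{Op}\,x\,k\mapsto c_{\mathtt{Op}}]_{\mathtt{Op}\in\mathcal O}\}$, $\mathcal O$ a finite set. - Computations $c ::= \mathtt{return}\,v \mid \mathtt{Op}\,v\,(y{:}T.c) \mid \mathtt{do}\,x\leftarrow c_1;c_2 \mid \mathtt{with}\,v\,\mathtt{handle}\,c \mid v_1\,v_2 \mid \mathtt{let}\,x=v\,\mathtt{in}\,c \mid c\rhd\gamma$. - Environments $\Gamma ::=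 \epsilon \mid \Gamma,\varsigma \mid \Gamma,\alpha{:}\tau \mid \Gamma,\delta \mid \Gamma,x{:}T \mid \Gamma,\omega{:}\pi$. *Signature.* $\Sigma$ assigns to each declared operation a pair of types, written $(\mathtt{Op}:A\to B)\in\Sigma$. All these $A,B$ are closed (no free variables) and well-formed in the empty environment. *Well-formedness.* $\Gamma\vdash\tau$ means that all free skeleton variables of $\tau$ are in $\Gamma$. $\Gamma\vdash\Delta$ means that the variable of $\Delta$, if any, is in $\Gamma$ and its operations are declared in $\Sigma$. $\Gamma\vdash T:\tau$ is generated by: $\Gamma\vdash\alpha:\tau$ if $(\alpha{:}\tau)\in\Gamma$; $\Gamma\vdash\mathtt{Unit}:\mathtt{Unit}$; $\to$ and $\Rrightarrow$ componentwise; $\Gamma\vdash\forall\varsigma.T:\forall\varsigma.\tau$ if $\Gamma,\varsigma\vdash T:\tau$; $\Gamma\vdash\forall\alpha{:}\tau_1.T:\tau$ if $\Gamma,\alpha{:}\tau_1\vdash T:\tau$; $\Gamma\vdash\forall\delta.T:\tau$ if $\Gamma,\delta\vdash T:\tau$; $\Gamma\vdash\pi\Rightarrow T:\tau$ if $\Gamma\vdash\pi$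 and $\Gamma\vdash T:\tau$. Moreover $\Gamma\vdash T\,!\,\Delta:\tau$ if $\Gamma\vdash T:\tau$ and $\Gamma\vdash\Delta$; $\Gamma\vdash T_1\le T_2$ if $T_1,T_2$ are well-formed with the same skeleton; $\Gamma\vdash\Delta_1\le\Delta_2$ if both dirts are well-formed. *Coercion typing* $\Gamma\vdash\gamma:\rho$. $\omega:\pi$ if $(\omega{:}\pi)\in\Gamma$; $\langle\mathtt{Unit}\rangle:\mathtt{Unit}\le\mathtt{Unit}$; $\langle\alpha\rangle:\alpha\le\alpha$ for $\alpha$ in $\Gamma$; $\langle\Delta\rangle:\Delta\le\Delta$ and $\emptyset_\Delta:\emptyset\le\Delta$ for well-formed $\Delta$; $\{\mathtt{Op}\}\cup\gamma:\{\mathtt{Op}\}\cup\Delta_1\le\{\mathtt{Op}\}\cup\Delta_2$ if $\gamma:\Delta_1\le\Delta_2$ and $\mathtt{Op}$ is declared; $\gamma_1\to\gamma_2:(T_1\to C_1)\le(T_2\to C_2)$ if $\gamma_1:T_2\le T_1$, $\gamma_2:C_1\le C_2$; $\gamma_1\Rrightarrow\gamma_2:(C_1\Rrightarrow C_2)\le(C_3\Rrightarrow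 C_4)$ if $\gamma_1:C_3\le C_1$, $\gamma_2:C_2\le C_4$; $\gamma_1\,!\,\gamma_2:T_1\,!\,\Delta_1\le T_2\,!\,\Delta_2$ if $\gamma_1:T_1\le T_2$, $\gamma_2:\Delta_1\le\Delta_2$; and $\forall\varsigma.\gamma$, $\forall(\alpha{:}\tau).\gamma$, $\forall\delta.\gamma$, $\pi\Rightarrow\gamma$ (with $\Gamma\vdash\pi$) are congruences, typed with $\gamma:T_1\le T_2$ in the environment extended by the bound variable. Substituting $T$ for $\alpha$ turns $\langle\alpha\rangle$ into the reflexivity coercion of $T$, built by recursion on $T$ from these forms. *Term typing* $\Gamma\vdash v:T$, $\Gamma\vdash c:C$. - $x:T$ if $(x{:}T)\in\Gamma$; $\mathtt{unit}:\mathtt{Unit}$; $(\mathtt{fun}\,(x{:}T)\mapsto c):T\to C$ if $\Gamma,x{:}T\vdash c:C$ and $T$ is well-formed; $v\rhd\gamma:T_2$ if $v:T_1$, $\gamma:T_1\le T_2$; $\Lambda\varsigma.v:\forall\varsigma.T$, $\Lambda\alpha{:}\tau.v:\forall\alpha{:}\tau.T$, $\Lambda\delta.v:\forall\delta.T$, $\Lambda(\omega{:}\pi).v:\pi\Rightarrow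 T$ (with $\Gamma\vdash\pi$) if $v:T$ in the extended environment. - $v\,\tau:T[\tau/\varsigma]$ if $v:\forall\varsigma.T$, $\Gamma\vdash\tau$; $v\,T_2:T_1[T_2/\alpha]$ if $v:\forall\alpha{:}\tau.T_1$, $\Gamma\vdash T_2:\tau$; $v\,\Delta:T[\Delta/\delta]$ if $v:\forall\delta.T$, $\Gamma\vdash\Delta$; $v\,\gamma:T$ if $v:\pi\Rightarrow T$, $\gamma:\pi$. - A handler as above with return clause $(x{:}T_x)\mapsto c_r$ has type $T_x\,!\,(\Delta\cup\mathcal O)\Rrightarrow T\,!\,\Delta$ if $\Gamma,x{:}T_x\vdash c_r:T\,!\,\Delta$ and, for every $\mathtt{Op}\in\mathcal O$, $(\mathtt{Op}:A\to B)\in\Sigma$ and $\Gamma,x{:}A,k{:}B\to T\,!\,\Delta\vdash c_{\mathtt{Op}}:T\,!\,\Delta$. - $v_1\,v_2:C$ if $v_1:T\to C$, $v_2:T$; $\mathtt{let}\,x=v\,\mathtt{in}\,c:C$ if $v:T$, $\Gamma,x{:}T\vdash c:C$; $\mathtt{return}\,v:T\,!\,\emptyset$ if $v:T$; $\mathtt{do}\,x\leftarrow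 c_1;c_2:T_2\,!\,\Delta$ if $c_1:T_1\,!\,\Delta$, $\Gamma,x{:}T_1\vdash c_2:T_2\,!\,\Delta$; $\mathtt{Op}\,v\,(y{:}B.c):T\,!\,\Delta$ if $(\mathtt{Op}:A\to B)\in\Sigma$, $v:A$, $\Gamma,y{:}B\vdash c:T\,!\,\Delta$, $\mathtt{Op}\in\Delta$; $\mathtt{with}\,v\,\mathtt{handle}\,c:C_2$ if $v:C_1\Rrightarrow C_2$, $c:C_1$; $c\rhd\gamma:C_2$ if $c:C_1$, $\gamma:C_1\le C_2$. *Results.* Terminal values $v^T$: $\mathtt{unit}$, $\mathtt{fun}$, handlers and the four $\Lambda$-abstractions. Value results: $v^R ::= v^T\mid v^R\rhd\gamma$ with $\gamma$ of one of the forms $\gamma_1\to\gamma_2$, $\gamma_1\Rrightarrow\gamma_2$, $\forall\varsigma.\gamma'$, $\forall(\alpha{:}\tau).\gamma'$, $\forall\delta.\gamma'$, $\pi\Rightarrow\gamma'$. Terminal computations: $c^T ::= \mathtt{return}\,v^R\mid c^T\rhd(\gamma_1\,!\,\gamma_2)$. Computation results: $c^R ::= c^T\mid\mathtt{Op}\,v^R\,(y{:}T.c)$.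 *Small steps* $v\leadsto v'$ and $c\leadsto c'$ are the least relations with the following rules. - Congruences: evaluation under $\cdot\rhd\gamma$ (values and computations), in the head of $v\,\tau$, $v\,T$, $v\,\Delta$, $v\,\gamma$, in $v_1$ of $v_1\,v_2$, in $v_2$ of $v^T\,v_2$, in $v$ of $\mathtt{let}\,x=v\,\mathtt{in}\,c$, $\mathtt{return}\,v$, $\mathtt{Op}\,v\,(y{:}T.c)$ and $\mathtt{with}\,v\,\mathtt{handle}\,c$, in $c_1$ of $\mathtt{do}\,x\leftarrow c_1;c_2$, and in $c$ of $\mathtt{with}\,v^T\,\mathtt{handle}\,c$. - $\beta$: $(\Lambda\varsigma.v)\,\tau\leadsto v[\tau/\varsigma]$, $(\Lambda\alpha{:}\tau.v)\,T\leadsto v[T/\alpha]$, $(\Lambda\delta.v)\,\Delta\leadsto v[\Delta/\delta]$, $(\Lambda(\omega{:}\pi).v)\,\gamma\leadsto v[\gamma/\omega]$, $(\mathtt{fun}\,(x{:}T)\mapsto c)\,v^R\leadsto c[v^R/x]$, $\mathtt{let}\,x=v^R\,\mathtt{in}\,c\leadsto c[v^R/x]$. - Push: $v^R\rhd\langle\mathtt{Unit}\rangle\leadsto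 v^R$; $(v^R\rhd\forall\varsigma.\gamma)\,\tau\leadsto(v^R\,\tau)\rhd\gamma[\tau/\varsigma]$; $(v^R\rhd\forall(\alpha{:}\tau).\gamma)\,T\leadsto(v^R\,T)\rhd\gamma[T/\alpha]$; $(v^R\rhd\forall\delta.\gamma)\,\Delta\leadsto(v^R\,\Delta)\rhd\gamma[\Delta/\delta]$; $(v^R\rhd(\pi\Rightarrow\gamma_1))\,\gamma_2\leadsto(v^R\,\gamma_2)\rhd\gamma_1$; $(v^R\rhd(\gamma_1\to\gamma_2))\,v\leadsto(v^R\,(v\rhd\gamma_1))\rhd\gamma_2$; $(\mathtt{Op}\,v^R\,(x{:}T.c))\rhd\gamma\leadsto\mathtt{Op}\,v^R\,(x{:}T.\,c\rhd\gamma)$; $\mathtt{with}\,(v^R\rhd(\gamma_1\Rrightarrow\gamma_2))\,\mathtt{handle}\,c\leadsto(\mathtt{with}\,v^R\,\mathtt{handle}\,(c\rhd\gamma_1))\rhd\gamma_2$. - Sequencing and handling, where $r=\mathtt{return}\,v^R\rhd(\gamma_1\,!\,\gamma_1')\rhd\dots\rhd(\gamma_n\,!\,\gamma_n')$ and $w=v^R\rhd\gamma_1\rhd\dots\rhd\gamma_n$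 ($n\ge0$): $\mathtt{do}\,x\leftarrow r;c_2\leadsto c_2[w/x]$; $\mathtt{do}\,x\leftarrow\mathtt{Op}\,v^R\,(y{:}T.c_1);c_2\leadsto\mathtt{Op}\,v^R\,(y{:}T.\,\mathtt{do}\,x\leftarrow c_1;c_2)$; $\mathtt{with}\,h\,\mathtt{handle}\,r\leadsto c_r[w/x]$; $\mathtt{with}\,h\,\mathtt{handle}\,\mathtt{Op}\,v^R\,(y{:}T.c)$ steps to $c_{\mathtt{Op}}[v^R/x,(\mathtt{fun}\,(y{:}T)\mapsto\mathtt{with}\,h\,\mathtt{handle}\,c)/k]$ if $h$ has a clause for $\mathtt{Op}$, and to $\mathtt{Op}\,v^R\,(y{:}T.\,\mathtt{with}\,h\,\mathtt{handle}\,c)$ if it has none. *Claim.* Let $\Gamma$ be any environment. 1. If $\Gamma\vdash v:T$, then every $v'$ with $v\leadsto v'$ satisfies $\Gamma\vdash v':T$. If moreover $\Gamma$ declares no term variables and no coercion variables (for instance $\Gamma=\epsilon$), then $v$ is a value result, or there is $v'$ with $v\leadsto v'$ and $\Gamma\vdash v':T$. 2. If $\Gamma\vdash c:C$ and $\Gamma$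 declares no coercion variable of a type $\Delta_1\le\Delta_2$, then every $c'$ with $c\leadsto c'$ satisfies $\Gamma\vdash c':C$. If $\Gamma\vdash c:C$ and $\Gamma$ declares no term variables and no coercion variables, then $c$ is a computation result, or there is $c'$ with $c\leadsto c'$ and $\Gamma\vdash c':C$. -/

import Mathlib

/-!
The calculus ExEff.  Terms and types are taken up to renaming of bound variables, by means of
de Bruijn indices.  There are five sorts of variables (skeleton, type, dirt, coercion and term
variables); each sort has its own indices, counted from the innermost binder of that sort.
Operation names range over an arbitrary type `Op`.
-/

namespace ExEff

universe u

/-! ### Syntax of types -/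

/-- Skeletons `τ`. -/
inductive Skel : Type
  | var (n : ℕ)
  | unit
  | arr (t1 t2 : Skel)
  | hnd (t1 t2 : Skel)
  /-- `∀ ς. τ` -/
  | all (t : Skel)

/-- Dirts `Δ`, built from `∅` or a dirt variable by `{op} ∪ Δ`, as sets: the order and the
multiplicity of operations do not matter.  So a dirt is a finite set of operations together with
a terminator, `none` for `∅` and `some n` for the dirt variable `n`. -/
structure Dirt (Op : Type u) : Type u where
  ops : Finset Op
  tail : Option ℕ

mutual
/-- Value types. -/
inductive VTy (Op : Type u) : Type u
  | var (n : ℕ)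
  | unit
  | arr (T : VTy Op) (C : CTy Op)
  | hnd (C D : CTy Op)
  /-- `∀ ς. T` -/
  | allSk (T : VTy Op)
  /-- `∀ α : τ. T` -/
  | allTy (t : Skel) (T : VTy Op)
  /-- `∀ δ. T` -/
  | allDi (T : VTy Op)
  /-- `π ⇒ T` -/
  | qual (p : SCt Op) (T : VTy Op)
/-- Computation types `T ! Δ`. -/
inductive CTy (Op : Type u) : Type u
  | mk (T : VTy Op) (D : Dirt Op)
/-- Simple coercion types `π`: `T₁ ≤ T₂` or `Δ₁ ≤ Δ₂`. -/
inductive SCt (Op : Type u) : Type u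
  | vle (T1 T2 : VTy Op)
  | dle (D1 D2 : Dirt Op)
end

/-- Coercion types `ρ`: `π` or `C₁ ≤ C₂`. -/
inductive FCt (Op : Type u) : Type u
  | simple (p : SCt Op)
  | cle (C1 C2 : CTy Op)

/-! ### Syntax of coercions and terms -/

/-- Coercions `γ`. -/
inductive Co (Op : Type u) : Type u
  | var (n : ℕ)
  /-- `⟨Unit⟩` -/
  | unitRefl
  /-- `⟨α⟩` -/
  | tyRefl (n : ℕ)
  /-- `⟨Δ⟩` -/
  | diRefl (D : Dirt Op)
  | arr (g1 g2 : Co Op)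
  | hnd (g1 g2 : Co Op)
  /-- `∅_Δ` -/
  | empty (D : Dirt Op)
  /-- `{op} ∪ γ` -/
  | insert (op : Op) (g : Co Op)
  /-- `∀ ς. γ` -/
  | allSk (g : Co Op)
  /-- `∀ (α : τ). γ` -/
  | allTy (t : Skel) (g : Co Op)
  /-- `∀ δ. γ` -/
  | allDi (g : Co Op)
  /-- `π ⇒ γ` -/
  | qual (p : SCt Op) (g : Co Op)
  /-- `γ₁ ! γ₂` -/
  | comp (g1 g2 : Co Op)

mutual
/-- Values. -/
inductive Val (Op : Type u) : Type u
  | var (n : ℕ)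
  | unit
  /-- `fun (x : T) ↦ c`, binding `x` -/
  | lam (T : VTy Op) (c : Comp Op)
  /-- The handler `{ return (x : T) ↦ c, clauses }`, binding `x` in `c`. -/
  | hand (T : VTy Op) (c : Comp Op) (h : Clauses Op)
  /-- `Λ ς. v` -/
  | skLam (v : Val Op)
  | skApp (v : Val Op) (t : Skel)
  /-- `Λ α : τ. v` -/
  | tyLam (t : Skel) (v : Val Op)
  | tyApp (v : Val Op) (T : VTy Op)
  /-- `Λ δ. v` -/
  | diLam (v : Val Op)
  | diApp (v : Val Op) (D : Dirt Op)
  /-- `Λ (ω : π). v` -/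
  | coLam (p : SCt Op) (v : Val Op)
  | coApp (v : Val Op) (g : Co Op)
  /-- `v ▷ γ` -/
  | cast (v : Val Op) (g : Co Op)
/-- Computations. -/
inductive Comp (Op : Type u) : Type u
  | ret (v : Val Op)
  /-- `op v (y : T. c)`, binding `y` in `c` -/
  | op (o : Op) (v : Val Op) (T : VTy Op) (c : Comp Op)
  /-- `do x ← c₁; c₂`, binding `x` in `c₂` -/
  | bind (c1 c2 : Comp Op)
  /-- `with v handle c` -/
  | handle (v : Val Op) (c : Comp Op)
  | app (v1 v2 : Val Op)
  /-- `let x = v in c`, binding `x` in `c` -/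
  | letv (v : Val Op) (c : Comp Op)
  /-- `c ▷ γ` -/
  | cast (c : Comp Op) (g : Co Op)
/-- The operation clauses `op x k ↦ c` of a handler.  A clause binds `x` and `k`, where `k` has
index `0` and `x` has index `1`. -/
inductive Clauses (Op : Type u) : Type u
  | nil
  | cons (o : Op) (c : Comp Op) (h : Clauses Op)
end

section
variable {Op : Type u}

/-- The operations that have a clause. -/
def Clauses.opList : Clauses Op → List Op
  | .nil => []
  | .cons o _ h => o :: h.opList

/-- The body of the clause for an operation, if there is one. -/
def Clauses.lookup [DecidableEq Op] : Clauses Op → Op → Option (Comp Op)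
  | .nil, _ => none
  | .cons o c h, o' => if o = o' then some c else h.lookup o'

/-! ### Operations on dirts -/

/-- `∅` -/
def Dirt.nil : Dirt Op := ⟨∅, none⟩

/-- The dirt variable `δ` with index `n`. -/
def Dirt.var (n : ℕ) : Dirt Op := ⟨∅, some n⟩

/-- `Δ ∪ O` -/
def Dirt.addOps [DecidableEq Op] (D : Dirt Op) (O : Finset Op) : Dirt Op := ⟨D.ops ∪ O, D.tail⟩

/-- `{op} ∪ Δ` -/
def Dirt.cons [DecidableEq Op] (o : Op) (D : Dirt Op) : Dirt Op := ⟨insert o D.ops, D.tail⟩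

/-! ### Renamings -/

/-- `scons a f` maps `0` to `a` and `n + 1` to `f n`. -/
def scons {A : Type u} (a : A) (f : ℕ → A) : ℕ → A
  | 0 => a
  | n + 1 => f n

/-- The extension of a renaming of one sort under a binder of that sort. -/
def upr (f : ℕ → ℕ) : ℕ → ℕ
  | 0 => 0
  | n + 1 => f n + 1

/-- Renamings of skeleton, type and dirt variables. -/
structure TyRen : Type where
  sk : ℕ → ℕ
  ty : ℕ → ℕ
  di : ℕ → ℕ

/-- Renamings of all sorts of variables. -/
structure Ren : Type extends TyRen where
  co : ℕ → ℕ
  tm : ℕ → ℕ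

def TyRen.ident : TyRen := ⟨id, id, id⟩
def TyRen.upSk (r : TyRen) : TyRen := { r with sk := upr r.sk }
def TyRen.upTy (r : TyRen) : TyRen := { r with ty := upr r.ty }
def TyRen.upDi (r : TyRen) : TyRen := { r with di := upr r.di }

def Ren.ident : Ren := ⟨TyRen.ident, id, id⟩
def Ren.upSk (r : Ren) : Ren := { r with sk := upr r.sk }
def Ren.upTy (r : Ren) : Ren := { r with ty := upr r.ty }
def Ren.upDi (r : Ren) : Ren := { r with di := upr r.di }
def Ren.upCo (r : Ren) : Ren := { r with co := upr r.co }
def Ren.upTm (r : Ren) : Ren := { r with tm := upr r.tm }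

/-- Weakenings by one variable of the given sort. -/
def Ren.wkSk : Ren := { Ren.ident with sk := Nat.succ }
def Ren.wkTy : Ren := { Ren.ident with ty := Nat.succ }
def Ren.wkDi : Ren := { Ren.ident with di := Nat.succ }
def Ren.wkCo : Ren := { Ren.ident with co := Nat.succ }
def Ren.wkTm : Ren := { Ren.ident with tm := Nat.succ }

def Skel.rename (f : ℕ → ℕ) : Skel → Skel
  | .var n => .var (f n)
  | .unit => .unit
  | .arr t1 t2 => .arr (t1.rename f) (t2.rename f)
  | .hnd t1 t2 => .hnd (t1.rename f) (t2.rename f)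
  | .all t => .all (t.rename (upr f))

def Dirt.rename (f : ℕ → ℕ) (D : Dirt Op) : Dirt Op := ⟨D.ops, D.tail.map f⟩

mutual
def VTy.rename (r : TyRen) : VTy Op → VTy Op
  | .var n => .var (r.ty n)
  | .unit => .unit
  | .arr T C => .arr (T.rename r) (C.rename r)
  | .hnd C D => .hnd (C.rename r) (D.rename r)
  | .allSk T => .allSk (T.rename r.upSk)
  | .allTy t T => .allTy (t.rename r.sk) (T.rename r.upTy)
  | .allDi T => .allDi (T.rename r.upDi)
  | .qual p T => .qual (p.rename r) (T.rename r)
def CTy.rename (r : TyRen) : CTy Op → CTy Op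
  | .mk T D => .mk (T.rename r) (D.rename r.di)
def SCt.rename (r : TyRen) : SCt Op → SCt Op
  | .vle T1 T2 => .vle (T1.rename r) (T2.rename r)
  | .dle D1 D2 => .dle (D1.rename r.di) (D2.rename r.di)
end

/-- Renaming in coercions, with `f` acting on the coercion variables. -/
def Co.rename (r : TyRen) (f : ℕ → ℕ) : Co Op → Co Op
  | .var n => .var (f n)
  | .unitRefl => .unitRefl
  | .tyRefl n => .tyRefl (r.ty n)
  | .diRefl D => .diRefl (D.rename r.di)
  | .arr g1 g2 => .arr (g1.rename r f) (g2.rename r f)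
  | .hnd g1 g2 => .hnd (g1.rename r f) (g2.rename r f)
  | .empty D => .empty (D.rename r.di)
  | .insert o g => .insert o (g.rename r f)
  | .allSk g => .allSk (g.rename r.upSk f)
  | .allTy t g => .allTy (t.rename r.sk) (g.rename r.upTy f)
  | .allDi g => .allDi (g.rename r.upDi f)
  | .qual p g => .qual (p.rename r) (g.rename r f)
  | .comp g1 g2 => .comp (g1.rename r f) (g2.rename r f)

mutual
def Val.rename (r : Ren) : Val Op → Val Op
  | .var n => .var (r.tm n)
  | .unit => .unit
  | .lam T c => .lam (T.rename r.toTyRen) (c.rename r.upTm)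
  | .hand T c h => .hand (T.rename r.toTyRen) (c.rename r.upTm) (h.rename r)
  | .skLam v => .skLam (v.rename r.upSk)
  | .skApp v t => .skApp (v.rename r) (t.rename r.sk)
  | .tyLam t v => .tyLam (t.rename r.sk) (v.rename r.upTy)
  | .tyApp v T => .tyApp (v.rename r) (T.rename r.toTyRen)
  | .diLam v => .diLam (v.rename r.upDi)
  | .diApp v D => .diApp (v.rename r) (D.rename r.di)
  | .coLam p v => .coLam (p.rename r.toTyRen) (v.rename r.upCo)
  | .coApp v g => .coApp (v.rename r) (g.rename r.toTyRen r.co)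
  | .cast v g => .cast (v.rename r) (g.rename r.toTyRen r.co)
def Comp.rename (r : Ren) : Comp Op → Comp Op
  | .ret v => .ret (v.rename r)
  | .op o v T c => .op o (v.rename r) (T.rename r.toTyRen) (c.rename r.upTm)
  | .bind c1 c2 => .bind (c1.rename r) (c2.rename r.upTm)
  | .handle v c => .handle (v.rename r) (c.rename r)
  | .app v1 v2 => .app (v1.rename r) (v2.rename r)
  | .letv v c => .letv (v.rename r) (c.rename r.upTm)
  | .cast c g => .cast (c.rename r) (g.rename r.toTyRen r.co)
def Clauses.rename (r : Ren) : Clauses Op → Clauses Op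
  | .nil => .nil
  | .cons o c h => .cons o (c.rename r.upTm.upTm) (h.rename r)
end

/-! ### Reflexivity coercions of arbitrary types -/

mutual
/-- The coercion `⟨T⟩` that witnesses `T ≤ T`. -/
def VTy.reflCo : VTy Op → Co Op
  | .var n => .tyRefl n
  | .unit => .unitRefl
  | .arr T C => .arr T.reflCo C.reflCo
  | .hnd C D => .hnd C.reflCo D.reflCo
  | .allSk T => .allSk T.reflCo
  | .allTy t T => .allTy t T.reflCo
  | .allDi T => .allDi T.reflCo
  | .qual p T => .qual p T.reflCo
def CTy.reflCo : CTy Op → Co Op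
  | .mk T D => .comp T.reflCo (.diRefl D)
end

/-! ### Substitutions -/

/-- Simultaneous substitutions for skeleton, type and dirt variables. -/
structure TySub (Op : Type u) : Type u where
  sk : ℕ → Skel
  ty : ℕ → VTy Op
  di : ℕ → Dirt Op

/-- Simultaneous substitutions for all sorts of variables. -/
structure Subst (Op : Type u) : Type u extends TySub Op where
  co : ℕ → Co Op
  tm : ℕ → Val Op

def Skel.ups (f : ℕ → Skel) : ℕ → Skel
  | 0 => .var 0
  | n + 1 => (f n).rename Nat.succ

def TySub.ident : TySub Op := ⟨Skel.var, VTy.var, Dirt.var⟩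

def TySub.upSk (s : TySub Op) : TySub Op where
  sk := Skel.ups s.sk
  ty := fun n => (s.ty n).rename Ren.wkSk.toTyRen
  di := s.di

def TySub.upTy (s : TySub Op) : TySub Op where
  sk := s.sk
  ty := scons (.var 0) fun n => (s.ty n).rename Ren.wkTy.toTyRen
  di := s.di

def TySub.upDi (s : TySub Op) : TySub Op where
  sk := s.sk
  ty := fun n => (s.ty n).rename Ren.wkDi.toTyRen
  di := scons (.var 0) fun n => (s.di n).rename Nat.succ

def Subst.ident : Subst Op := ⟨TySub.ident, Co.var, Val.var⟩

def Subst.upSk (s : Subst Op) : Subst Op where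
  toTySub := s.toTySub.upSk
  co := fun n => (s.co n).rename Ren.wkSk.toTyRen id
  tm := fun n => (s.tm n).rename Ren.wkSk

def Subst.upTy (s : Subst Op) : Subst Op where
  toTySub := s.toTySub.upTy
  co := fun n => (s.co n).rename Ren.wkTy.toTyRen id
  tm := fun n => (s.tm n).rename Ren.wkTy

def Subst.upDi (s : Subst Op) : Subst Op where
  toTySub := s.toTySub.upDi
  co := fun n => (s.co n).rename Ren.wkDi.toTyRen id
  tm := fun n => (s.tm n).rename Ren.wkDi

def Subst.upCo (s : Subst Op) : Subst Op where
  toTySub := s.toTySub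
  co := scons (.var 0) fun n => (s.co n).rename TyRen.ident Nat.succ
  tm := fun n => (s.tm n).rename Ren.wkCo

def Subst.upTm (s : Subst Op) : Subst Op where
  toTySub := s.toTySub
  co := s.co
  tm := scons (.var 0) fun n => (s.tm n).rename Ren.wkTm

def Skel.subst (f : ℕ → Skel) : Skel → Skel
  | .var n => f n
  | .unit => .unit
  | .arr t1 t2 => .arr (t1.subst f) (t2.subst f)
  | .hnd t1 t2 => .hnd (t1.subst f) (t2.subst f)
  | .all t => .all (t.subst (Skel.ups f))

def Dirt.subst [DecidableEq Op] (f : ℕ → Dirt Op) (D : Dirt Op) : Dirt Op :=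
  match D.tail with
  | none => D
  | some n => (f n).addOps D.ops

mutual
def VTy.subst [DecidableEq Op] (s : TySub Op) : VTy Op → VTy Op
  | .var n => s.ty n
  | .unit => .unit
  | .arr T C => .arr (T.subst s) (C.subst s)
  | .hnd C D => .hnd (C.subst s) (D.subst s)
  | .allSk T => .allSk (T.subst s.upSk)
  | .allTy t T => .allTy (t.subst s.sk) (T.subst s.upTy)
  | .allDi T => .allDi (T.subst s.upDi)
  | .qual p T => .qual (p.subst s) (T.subst s)
def CTy.subst [DecidableEq Op] (s : TySub Op) : CTy Op → CTy Op
  | .mk T D => .mk (T.subst s) (D.subst s.di)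
def SCt.subst [DecidableEq Op] (s : TySub Op) : SCt Op → SCt Op
  | .vle T1 T2 => .vle (T1.subst s) (T2.subst s)
  | .dle D1 D2 => .dle (D1.subst s.di) (D2.subst s.di)
end

/-- Substitution in coercions, with `f` acting on the coercion variables.  Substituting a type
`T` for `α` turns `⟨α⟩` into the reflexivity coercion of `T`. -/
def Co.subst [DecidableEq Op] (s : TySub Op) (f : ℕ → Co Op) : Co Op → Co Op
  | .var n => f n
  | .unitRefl => .unitRefl
  | .tyRefl n => (s.ty n).reflCo
  | .diRefl D => .diRefl (D.subst s.di)
  | .arr g1 g2 => .arr (g1.subst s f) (g2.subst s f)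
  | .hnd g1 g2 => .hnd (g1.subst s f) (g2.subst s f)
  | .empty D => .empty (D.subst s.di)
  | .insert o g => .insert o (g.subst s f)
  | .allSk g => .allSk (g.subst s.upSk fun n => (f n).rename Ren.wkSk.toTyRen id)
  | .allTy t g =>
      .allTy (t.subst s.sk) (g.subst s.upTy fun n => (f n).rename Ren.wkTy.toTyRen id)
  | .allDi g => .allDi (g.subst s.upDi fun n => (f n).rename Ren.wkDi.toTyRen id)
  | .qual p g => .qual (p.subst s) (g.subst s f)
  | .comp g1 g2 => .comp (g1.subst s f) (g2.subst s f)

mutual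
def Val.subst [DecidableEq Op] (s : Subst Op) : Val Op → Val Op
  | .var n => s.tm n
  | .unit => .unit
  | .lam T c => .lam (T.subst s.toTySub) (c.subst s.upTm)
  | .hand T c h => .hand (T.subst s.toTySub) (c.subst s.upTm) (h.subst s)
  | .skLam v => .skLam (v.subst s.upSk)
  | .skApp v t => .skApp (v.subst s) (t.subst s.sk)
  | .tyLam t v => .tyLam (t.subst s.sk) (v.subst s.upTy)
  | .tyApp v T => .tyApp (v.subst s) (T.subst s.toTySub)
  | .diLam v => .diLam (v.subst s.upDi)
  | .diApp v D => .diApp (v.subst s) (D.subst s.di)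
  | .coLam p v => .coLam (p.subst s.toTySub) (v.subst s.upCo)
  | .coApp v g => .coApp (v.subst s) (g.subst s.toTySub s.co)
  | .cast v g => .cast (v.subst s) (g.subst s.toTySub s.co)
def Comp.subst [DecidableEq Op] (s : Subst Op) : Comp Op → Comp Op
  | .ret v => .ret (v.subst s)
  | .op o v T c => .op o (v.subst s) (T.subst s.toTySub) (c.subst s.upTm)
  | .bind c1 c2 => .bind (c1.subst s) (c2.subst s.upTm)
  | .handle v c => .handle (v.subst s) (c.subst s)
  | .app v1 v2 => .app (v1.subst s) (v2.subst s)
  | .letv v c => .letv (v.subst s) (c.subst s.upTm)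
  | .cast c g => .cast (c.subst s) (g.subst s.toTySub s.co)
def Clauses.subst [DecidableEq Op] (s : Subst Op) : Clauses Op → Clauses Op
  | .nil => .nil
  | .cons o c h => .cons o (c.subst s.upTm.upTm) (h.subst s)
end

/-- `[τ/ς]`, `[T/α]`, `[Δ/δ]`, `[γ/ω]` and `[v/x]`, for the variable with index `0`. -/
def TySub.instSk (t : Skel) : TySub Op := { TySub.ident with sk := scons t Skel.var }
def TySub.instTy (T : VTy Op) : TySub Op := { TySub.ident with ty := scons T VTy.var }
def TySub.instDi (D : Dirt Op) : TySub Op := { TySub.ident with di := scons D Dirt.var }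
def Subst.instSk (t : Skel) : Subst Op := ⟨TySub.instSk t, Co.var, Val.var⟩
def Subst.instTy (T : VTy Op) : Subst Op := ⟨TySub.instTy T, Co.var, Val.var⟩
def Subst.instDi (D : Dirt Op) : Subst Op := ⟨TySub.instDi D, Co.var, Val.var⟩
def Subst.instCo (g : Co Op) : Subst Op := ⟨TySub.ident, scons g Co.var, Val.var⟩
def Subst.instTm (v : Val Op) : Subst Op := ⟨TySub.ident, Co.var, scons v Val.var⟩

/-- `[v/x, w/k]`, where `k` has index `0` and `x` has index `1`. -/
def Subst.instTm2 (v w : Val Op) : Subst Op :=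
  ⟨TySub.ident, Co.var, scons w (scons v Val.var)⟩

/-! ### Typing environments -/

end

/-- The entries of a typing environment: `ς`, `α : τ`, `δ`, `x : T` and `ω : π`. -/
inductive Binding (Op : Type u) : Type u
  | sk
  | ty (t : Skel)
  | di
  | tm (T : VTy Op)
  | co (p : SCt Op)

/-- Typing environments, with the most recent entry at the head. -/
abbrev Ctx (Op : Type u) : Type u := List (Binding Op)

section
variable {Op : Type u}

/-- The weakening that goes with adding an entry to an environment. -/
def Binding.wk : Binding Op → Ren
  | .sk => Ren.wkSk
  | .ty _ => Ren.wkTy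
  | .di => Ren.wkDi
  | .tm _ => Ren.wkTm
  | .co _ => Ren.wkCo

/-- `ς ∈ Γ` -/
inductive LookSk : Ctx Op → ℕ → Prop
  | here {G : Ctx Op} : LookSk (.sk :: G) 0
  | there {G : Ctx Op} {n : ℕ} (b : Binding Op) : LookSk G n → LookSk (b :: G) (b.wk.sk n)

/-- `(α : τ) ∈ Γ` -/
inductive LookTy : Ctx Op → ℕ → Skel → Prop
  | here {G : Ctx Op} {t : Skel} : LookTy (.ty t :: G) 0 t
  | there {G : Ctx Op} {n : ℕ} {t : Skel} (b : Binding Op) :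
      LookTy G n t → LookTy (b :: G) (b.wk.ty n) (t.rename b.wk.sk)

/-- `δ ∈ Γ` -/
inductive LookDi : Ctx Op → ℕ → Prop
  | here {G : Ctx Op} : LookDi (.di :: G) 0
  | there {G : Ctx Op} {n : ℕ} (b : Binding Op) : LookDi G n → LookDi (b :: G) (b.wk.di n)

/-- `(x : T) ∈ Γ` -/
inductive LookTm : Ctx Op → ℕ → VTy Op → Prop
  | here {G : Ctx Op} {T : VTy Op} : LookTm (.tm T :: G) 0 T
  | there {G : Ctx Op} {n : ℕ} {T : VTy Op} (b : Binding Op) :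
      LookTm G n T → LookTm (b :: G) (b.wk.tm n) (T.rename b.wk.toTyRen)

/-- `(ω : π) ∈ Γ` -/
inductive LookCo : Ctx Op → ℕ → SCt Op → Prop
  | here {G : Ctx Op} {p : SCt Op} : LookCo (.co p :: G) 0 p
  | there {G : Ctx Op} {n : ℕ} {p : SCt Op} (b : Binding Op) :
      LookCo G n p → LookCo (b :: G) (b.wk.co n) (p.rename b.wk.toTyRen)

/-- `Γ` consists of skeleton, type and dirt variables: it declares neither term variables nor
coercion variables. -/
def Ctx.TypeLevel (G : Ctx Op) : Prop :=
  (∀ T : VTy Op, Binding.tm T ∉ G) ∧ ∀ p : SCt Op, Binding.co p ∉ G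

/-- `Γ` declares no coercion variable `ω : Δ₁ ≤ Δ₂`. -/
def Ctx.NoDirtCo (G : Ctx Op) : Prop :=
  ∀ D1 D2 : Dirt Op, Binding.co (.dle D1 D2) ∉ G

end

/-- The global signature `Σ`, which assigns types `A` and `B` to the declared operations
`op : A → B`. -/
abbrev Sig (Op : Type u) : Type u := Op → Option (VTy Op × VTy Op)

section
variable {Op : Type u} [DecidableEq Op]

/-! ### Well-formedness -/

/-- `Γ ⊢ τ` -/
inductive WfSkel : Ctx Op → Skel → Prop
  | var {G : Ctx Op} {n : ℕ} : LookSk G n → WfSkel G (.var n)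
  | unit {G : Ctx Op} : WfSkel G .unit
  | arr {G : Ctx Op} {t1 t2 : Skel} : WfSkel G t1 → WfSkel G t2 → WfSkel G (.arr t1 t2)
  | hnd {G : Ctx Op} {t1 t2 : Skel} : WfSkel G t1 → WfSkel G t2 → WfSkel G (.hnd t1 t2)
  | all {G : Ctx Op} {t : Skel} : WfSkel (.sk :: G) t → WfSkel G (.all t)

/-- `Γ ⊢ Δ` -/
inductive WfDirt (S : Sig Op) : Ctx Op → Dirt Op → Prop
  | nil {G : Ctx Op} : WfDirt S G .nil
  | var {G : Ctx Op} {n : ℕ} : LookDi G n → WfDirt S G (.var n)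
  | cons {G : Ctx Op} {o : Op} {A B : VTy Op} {D : Dirt Op} :
      S o = some (A, B) → WfDirt S G D → WfDirt S G (.cons o D)

mutual
/-- `Γ ⊢ T : τ` for value types -/
inductive WfVTy (S : Sig Op) : Ctx Op → VTy Op → Skel → Prop
  | var {G : Ctx Op} {n : ℕ} {t : Skel} : LookTy G n t → WfVTy S G (.var n) t
  | unit {G : Ctx Op} : WfVTy S G .unit .unit
  | arr {G : Ctx Op} {T : VTy Op} {C : CTy Op} {t1 t2 : Skel} :
      WfVTy S G T t1 → WfCTy S G C t2 → WfVTy S G (.arr T C) (.arr t1 t2)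
  | hnd {G : Ctx Op} {C D : CTy Op} {t1 t2 : Skel} :
      WfCTy S G C t1 → WfCTy S G D t2 → WfVTy S G (.hnd C D) (.hnd t1 t2)
  | qual {G : Ctx Op} {p : SCt Op} {T : VTy Op} {t : Skel} :
      WfSCt S G p → WfVTy S G T t → WfVTy S G (.qual p T) t
  | allSk {G : Ctx Op} {T : VTy Op} {t : Skel} :
      WfVTy S (.sk :: G) T t → WfVTy S G (.allSk T) (.all t)
  | allTy {G : Ctx Op} {T : VTy Op} {t1 t2 : Skel} :
      WfVTy S (.ty t1 :: G) T t2 → WfVTy S G (.allTy t1 T) t2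
  | allDi {G : Ctx Op} {T : VTy Op} {t : Skel} :
      WfVTy S (.di :: G) T t → WfVTy S G (.allDi T) t
/-- `Γ ⊢ C : τ` for computation types -/
inductive WfCTy (S : Sig Op) : Ctx Op → CTy Op → Skel → Prop
  | mk {G : Ctx Op} {T : VTy Op} {D : Dirt Op} {t : Skel} :
      WfVTy S G T t → WfDirt S G D → WfCTy S G (.mk T D) t
/-- `Γ ⊢ π` for simple coercion types -/
inductive WfSCt (S : Sig Op) : Ctx Op → SCt Op → Prop
  | vle {G : Ctx Op} {T1 T2 : VTy Op} {t : Skel} :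
      WfVTy S G T1 t → WfVTy S G T2 t → WfSCt S G (.vle T1 T2)
  | dle {G : Ctx Op} {D1 D2 : Dirt Op} :
      WfDirt S G D1 → WfDirt S G D2 → WfSCt S G (.dle D1 D2)
end

/-- `T` has no free variables: no substitution changes it. -/
def VTy.Closed (T : VTy Op) : Prop := ∀ s : TySub Op, T.subst s = T

/-- The signature is well-formed: its types are closed, and well-formed in the empty
environment. -/
def Sig.WF (S : Sig Op) : Prop :=
  ∀ (o : Op) (A B : VTy Op), S o = some (A, B) →
    (A.Closed ∧ ∃ t : Skel, WfVTy S [] A t) ∧ (B.Closed ∧ ∃ t : Skel, WfVTy S [] B t)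

/-! ### Typing -/

/-- Coercion typing `Γ ⊢ γ : ρ` -/
inductive HasCo (S : Sig Op) : Ctx Op → Co Op → FCt Op → Prop
  | var {G : Ctx Op} {n : ℕ} {p : SCt Op} : LookCo G n p → HasCo S G (.var n) (.simple p)
  | tyRefl {G : Ctx Op} {n : ℕ} {t : Skel} :
      WfVTy S G (.var n) t → HasCo S G (.tyRefl n) (.simple (.vle (.var n) (.var n)))
  | diRefl {G : Ctx Op} {D : Dirt Op} :
      WfDirt S G D → HasCo S G (.diRefl D) (.simple (.dle D D))
  | unitRefl {G : Ctx Op} : HasCo S G .unitRefl (.simple (.vle .unit .unit))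
  | arr {G : Ctx Op} {g1 g2 : Co Op} {T1 T2 : VTy Op} {C1 C2 : CTy Op} :
      HasCo S G g1 (.simple (.vle T2 T1)) → HasCo S G g2 (.cle C1 C2) →
      HasCo S G (.arr g1 g2) (.simple (.vle (.arr T1 C1) (.arr T2 C2)))
  | hnd {G : Ctx Op} {g1 g2 : Co Op} {C1 C2 C3 C4 : CTy Op} :
      HasCo S G g1 (.cle C3 C1) → HasCo S G g2 (.cle C2 C4) →
      HasCo S G (.hnd g1 g2) (.simple (.vle (.hnd C1 C2) (.hnd C3 C4)))
  | allSk {G : Ctx Op} {g : Co Op} {T1 T2 : VTy Op} :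
      HasCo S (.sk :: G) g (.simple (.vle T1 T2)) →
      HasCo S G (.allSk g) (.simple (.vle (.allSk T1) (.allSk T2)))
  | allTy {G : Ctx Op} {t : Skel} {g : Co Op} {T1 T2 : VTy Op} :
      HasCo S (.ty t :: G) g (.simple (.vle T1 T2)) →
      HasCo S G (.allTy t g) (.simple (.vle (.allTy t T1) (.allTy t T2)))
  | allDi {G : Ctx Op} {g : Co Op} {T1 T2 : VTy Op} :
      HasCo S (.di :: G) g (.simple (.vle T1 T2)) →
      HasCo S G (.allDi g) (.simple (.vle (.allDi T1) (.allDi T2)))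
  | qual {G : Ctx Op} {p : SCt Op} {g : Co Op} {T1 T2 : VTy Op} :
      HasCo S G g (.simple (.vle T1 T2)) → WfSCt S G p →
      HasCo S G (.qual p g) (.simple (.vle (.qual p T1) (.qual p T2)))
  | empty {G : Ctx Op} {D : Dirt Op} :
      WfDirt S G D → HasCo S G (.empty D) (.simple (.dle .nil D))
  | comp {G : Ctx Op} {g1 g2 : Co Op} {T1 T2 : VTy Op} {D1 D2 : Dirt Op} :
      HasCo S G g1 (.simple (.vle T1 T2)) → HasCo S G g2 (.simple (.dle D1 D2)) →
      HasCo S G (.comp g1 g2) (.cle (.mk T1 D1) (.mk T2 D2))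
  | insert {G : Ctx Op} {o : Op} {A B : VTy Op} {g : Co Op} {D1 D2 : Dirt Op} :
      HasCo S G g (.simple (.dle D1 D2)) → S o = some (A, B) →
      HasCo S G (.insert o g) (.simple (.dle (.cons o D1) (.cons o D2)))

mutual
/-- Value typing `Γ ⊢ v : T` -/
inductive HasVal (S : Sig Op) : Ctx Op → Val Op → VTy Op → Prop
  | var {G : Ctx Op} {n : ℕ} {T : VTy Op} : LookTm G n T → HasVal S G (.var n) T
  | unit {G : Ctx Op} : HasVal S G .unit .unit
  | lam {G : Ctx Op} {T : VTy Op} {c : Comp Op} {C : CTy Op} {t : Skel} :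
      HasComp S (.tm T :: G) c C → WfVTy S G T t → HasVal S G (.lam T c) (.arr T C)
  | cast {G : Ctx Op} {v : Val Op} {g : Co Op} {T1 T2 : VTy Op} :
      HasVal S G v T1 → HasCo S G g (.simple (.vle T1 T2)) → HasVal S G (.cast v g) T2
  | skLam {G : Ctx Op} {v : Val Op} {T : VTy Op} :
      HasVal S (.sk :: G) v T → HasVal S G (.skLam v) (.allSk T)
  | tyLam {G : Ctx Op} {t : Skel} {v : Val Op} {T : VTy Op} :
      HasVal S (.ty t :: G) v T → HasVal S G (.tyLam t v) (.allTy t T)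
  | diLam {G : Ctx Op} {v : Val Op} {T : VTy Op} :
      HasVal S (.di :: G) v T → HasVal S G (.diLam v) (.allDi T)
  | coLam {G : Ctx Op} {p : SCt Op} {v : Val Op} {T : VTy Op} :
      HasVal S (.co p :: G) v T → WfSCt S G p → HasVal S G (.coLam p v) (.qual p T)
  | coApp {G : Ctx Op} {v : Val Op} {g : Co Op} {p : SCt Op} {T : VTy Op} :
      HasVal S G v (.qual p T) → HasCo S G g (.simple p) → HasVal S G (.coApp v g) T
  | hand {G : Ctx Op} {Tx T : VTy Op} {c : Comp Op} {h : Clauses Op} {D : Dirt Op} :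
      HasComp S (.tm Tx :: G) c (.mk T D) → h.opList.Nodup → HasClauses S G h T D →
      HasVal S G (.hand Tx c h) (.hnd (.mk Tx (D.addOps h.opList.toFinset)) (.mk T D))
  | skApp {G : Ctx Op} {v : Val Op} {T : VTy Op} {t : Skel} :
      HasVal S G v (.allSk T) → WfSkel G t → HasVal S G (.skApp v t) (T.subst (.instSk t))
  | tyApp {G : Ctx Op} {v : Val Op} {T1 T2 : VTy Op} {t : Skel} :
      HasVal S G v (.allTy t T1) → WfVTy S G T2 t →
      HasVal S G (.tyApp v T2) (T1.subst (.instTy T2))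
  | diApp {G : Ctx Op} {v : Val Op} {T : VTy Op} {D : Dirt Op} :
      HasVal S G v (.allDi T) → WfDirt S G D → HasVal S G (.diApp v D) (T.subst (.instDi D))
/-- Computation typing `Γ ⊢ c : C` -/
inductive HasComp (S : Sig Op) : Ctx Op → Comp Op → CTy Op → Prop
  | app {G : Ctx Op} {v1 v2 : Val Op} {T : VTy Op} {C : CTy Op} :
      HasVal S G v1 (.arr T C) → HasVal S G v2 T → HasComp S G (.app v1 v2) C
  | letv {G : Ctx Op} {v : Val Op} {c : Comp Op} {T : VTy Op} {C : CTy Op} :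
      HasVal S G v T → HasComp S (.tm T :: G) c C → HasComp S G (.letv v c) C
  | ret {G : Ctx Op} {v : Val Op} {T : VTy Op} :
      HasVal S G v T → HasComp S G (.ret v) (.mk T .nil)
  | bind {G : Ctx Op} {c1 c2 : Comp Op} {T1 T2 : VTy Op} {D : Dirt Op} :
      HasComp S G c1 (.mk T1 D) → HasComp S (.tm T1 :: G) c2 (.mk T2 D) →
      HasComp S G (.bind c1 c2) (.mk T2 D)
  | op {G : Ctx Op} {o : Op} {v : Val Op} {A B T : VTy Op} {c : Comp Op} {D : Dirt Op} :
      S o = some (A, B) → HasVal S G v A → HasComp S (.tm B :: G) c (.mk T D) →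
      o ∈ D.ops → HasComp S G (.op o v B c) (.mk T D)
  | handle {G : Ctx Op} {v : Val Op} {c : Comp Op} {C1 C2 : CTy Op} :
      HasVal S G v (.hnd C1 C2) → HasComp S G c C1 → HasComp S G (.handle v c) C2
  | cast {G : Ctx Op} {c : Comp Op} {g : Co Op} {C1 C2 : CTy Op} :
      HasComp S G c C1 → HasCo S G g (.cle C1 C2) → HasComp S G (.cast c g) C2
/-- The operation clauses of a handler into `T ! Δ`: for each clause `op x k ↦ c` with
`op : A → B` in the signature, `Γ, x : A, k : B → T ! Δ ⊢ c : T ! Δ`. -/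
inductive HasClauses (S : Sig Op) : Ctx Op → Clauses Op → VTy Op → Dirt Op → Prop
  | nil {G : Ctx Op} {T : VTy Op} {D : Dirt Op} : HasClauses S G .nil T D
  | cons {G : Ctx Op} {o : Op} {c : Comp Op} {h : Clauses Op} {A B T : VTy Op} {D : Dirt Op} :
      S o = some (A, B) →
      HasComp S (.tm (.arr B (.mk T D)) :: .tm A :: G) c (.mk T D) →
      HasClauses S G h T D → HasClauses S G (.cons o c h) T D
end

end

section
variable {Op : Type u}

/-! ### Results -/

/-- Terminal values -/
inductive TermVal : Val Op → Prop
  | unit : TermVal .unit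
  | lam (T : VTy Op) (c : Comp Op) : TermVal (.lam T c)
  | hand (T : VTy Op) (c : Comp Op) (h : Clauses Op) : TermVal (.hand T c h)
  | skLam (v : Val Op) : TermVal (.skLam v)
  | tyLam (t : Skel) (v : Val Op) : TermVal (.tyLam t v)
  | diLam (v : Val Op) : TermVal (.diLam v)
  | coLam (p : SCt Op) (v : Val Op) : TermVal (.coLam p v)

/-- Value results -/
inductive ResVal : Val Op → Prop
  | term {v : Val Op} : TermVal v → ResVal v
  | arr {v : Val Op} (g1 g2 : Co Op) : ResVal v → ResVal (.cast v (.arr g1 g2))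
  | hnd {v : Val Op} (g1 g2 : Co Op) : ResVal v → ResVal (.cast v (.hnd g1 g2))
  | allSk {v : Val Op} (g : Co Op) : ResVal v → ResVal (.cast v (.allSk g))
  | allTy {v : Val Op} (t : Skel) (g : Co Op) : ResVal v → ResVal (.cast v (.allTy t g))
  | allDi {v : Val Op} (g : Co Op) : ResVal v → ResVal (.cast v (.allDi g))
  | qual {v : Val Op} (p : SCt Op) (g : Co Op) : ResVal v → ResVal (.cast v (.qual p g))

/-- Terminal computations -/
inductive TermComp : Comp Op → Prop
  | ret {v : Val Op} : ResVal v → TermComp (.ret v)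
  | cast {c : Comp Op} (g1 g2 : Co Op) : TermComp c → TermComp (.cast c (.comp g1 g2))

/-- Computation results -/
inductive ResComp : Comp Op → Prop
  | term {c : Comp Op} : TermComp c → ResComp c
  | op {v : Val Op} (o : Op) (T : VTy Op) (c : Comp Op) : ResVal v → ResComp (.op o v T c)

/-! ### Operational semantics -/

/-- `return v ▷ (γ₁ ! γ₁') ▷ … ▷ (γₙ ! γₙ')` -/
def retCasts (v : Val Op) (l : List (Co Op × Co Op)) : Comp Op :=
  l.foldl (fun c g => .cast c (.comp g.1 g.2)) (.ret v)

/-- `v ▷ γ₁ ▷ … ▷ γₙ` -/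
def valCasts (v : Val Op) (l : List (Co Op × Co Op)) : Val Op :=
  l.foldl (fun w g => .cast w g.1) v

end

section
variable {Op : Type u} [DecidableEq Op]

/-- Small steps of values -/
inductive StepVal : Val Op → Val Op → Prop
  | cast {v v' : Val Op} (g : Co Op) : StepVal v v' → StepVal (.cast v g) (.cast v' g)
  | pushUnit {v : Val Op} : ResVal v → StepVal (.cast v .unitRefl) v
  | skApp {v v' : Val Op} (t : Skel) : StepVal v v' → StepVal (.skApp v t) (.skApp v' t)
  | tyApp {v v' : Val Op} (T : VTy Op) : StepVal v v' → StepVal (.tyApp v T) (.tyApp v' T)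
  | diApp {v v' : Val Op} (D : Dirt Op) : StepVal v v' → StepVal (.diApp v D) (.diApp v' D)
  | coApp {v v' : Val Op} (g : Co Op) : StepVal v v' → StepVal (.coApp v g) (.coApp v' g)
  | pushSkel {v : Val Op} (g : Co Op) (t : Skel) : ResVal v →
      StepVal (.skApp (.cast v (.allSk g)) t)
        (.cast (.skApp v t) (g.subst (.instSk t) Co.var))
  | pushTy {v : Val Op} (t : Skel) (g : Co Op) (T : VTy Op) : ResVal v →
      StepVal (.tyApp (.cast v (.allTy t g)) T)
        (.cast (.tyApp v T) (g.subst (.instTy T) Co.var))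
  | pushDirt {v : Val Op} (g : Co Op) (D : Dirt Op) : ResVal v →
      StepVal (.diApp (.cast v (.allDi g)) D)
        (.cast (.diApp v D) (g.subst (.instDi D) Co.var))
  | pushQual {v : Val Op} (p : SCt Op) (g1 g2 : Co Op) : ResVal v →
      StepVal (.coApp (.cast v (.qual p g1)) g2) (.cast (.coApp v g2) g1)
  | betaSkel (v : Val Op) (t : Skel) : StepVal (.skApp (.skLam v) t) (v.subst (.instSk t))
  | betaTy (t : Skel) (v : Val Op) (T : VTy Op) :
      StepVal (.tyApp (.tyLam t v) T) (v.subst (.instTy T))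
  | betaDirt (v : Val Op) (D : Dirt Op) : StepVal (.diApp (.diLam v) D) (v.subst (.instDi D))
  | betaCo (p : SCt Op) (v : Val Op) (g : Co Op) :
      StepVal (.coApp (.coLam p v) g) (v.subst (.instCo g))

/-- Small steps of computations.  A term that is moved under the binder of a continuation is
weakened. -/
inductive StepComp : Comp Op → Comp Op → Prop
  | cast {c c' : Comp Op} (g : Co Op) : StepComp c c' → StepComp (.cast c g) (.cast c' g)
  | appFun {v1 v1' : Val Op} (v2 : Val Op) : StepVal v1 v1' →
      StepComp (.app v1 v2) (.app v1' v2)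
  | pushApp {v1 : Val Op} (g1 g2 : Co Op) (v2 : Val Op) : ResVal v1 →
      StepComp (.app (.cast v1 (.arr g1 g2)) v2) (.cast (.app v1 (.cast v2 g1)) g2)
  | appArg {v1 v2 v2' : Val Op} : TermVal v1 → StepVal v2 v2' →
      StepComp (.app v1 v2) (.app v1 v2')
  | beta (T : VTy Op) (c : Comp Op) {v : Val Op} : ResVal v →
      StepComp (.app (.lam T c) v) (c.subst (.instTm v))
  | letStep {v v' : Val Op} (c : Comp Op) : StepVal v v' → StepComp (.letv v c) (.letv v' c)
  | letVal {v : Val Op} (c : Comp Op) : ResVal v → StepComp (.letv v c) (c.subst (.instTm v))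
  | ret {v v' : Val Op} : StepVal v v' → StepComp (.ret v) (.ret v')
  | op (o : Op) {v v' : Val Op} (T : VTy Op) (c : Comp Op) : StepVal v v' →
      StepComp (.op o v T c) (.op o v' T c)
  | pushOp (o : Op) {v : Val Op} (T : VTy Op) (c : Comp Op) (g : Co Op) : ResVal v →
      StepComp (.cast (.op o v T c) g) (.op o v T (.cast c g))
  | bind {c1 c1' : Comp Op} (c2 : Comp Op) : StepComp c1 c1' →
      StepComp (.bind c1 c2) (.bind c1' c2)
  | doRet {v : Val Op} (l : List (Co Op × Co Op)) (c2 : Comp Op) : ResVal v →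
      StepComp (.bind (retCasts v l) c2) (c2.subst (.instTm (valCasts v l)))
  | doOp (o : Op) {v : Val Op} (T : VTy Op) (c1 c2 : Comp Op) : ResVal v →
      StepComp (.bind (.op o v T c1) c2) (.op o v T (.bind c1 (c2.rename Ren.wkTm.upTm)))
  | handleFun {v v' : Val Op} (c : Comp Op) : StepVal v v' →
      StepComp (.handle v c) (.handle v' c)
  | pushHandle {v : Val Op} (g1 g2 : Co Op) (c : Comp Op) : ResVal v →
      StepComp (.handle (.cast v (.hnd g1 g2)) c) (.cast (.handle v (.cast c g1)) g2)
  | handleArg {v : Val Op} {c c' : Comp Op} : TermVal v → StepComp c c' →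
      StepComp (.handle v c) (.handle v c')
  | handleRet (T : VTy Op) (cr : Comp Op) (h : Clauses Op) {v : Val Op}
      (l : List (Co Op × Co Op)) : ResVal v →
      StepComp (.handle (.hand T cr h) (retCasts v l)) (cr.subst (.instTm (valCasts v l)))
  | handleOp1 (T : VTy Op) (cr : Comp Op) (h : Clauses Op) (o : Op) {v : Val Op} (U : VTy Op)
      (c co : Comp Op) : ResVal v → h.lookup o = some co →
      StepComp (.handle (.hand T cr h) (.op o v U c))
        (co.subst (.instTm2 v (.lam U (.handle ((Val.hand T cr h).rename Ren.wkTm) c))))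
  | handleOp2 (T : VTy Op) (cr : Comp Op) (h : Clauses Op) (o : Op) {v : Val Op} (U : VTy Op)
      (c : Comp Op) : ResVal v → h.lookup o = none →
      StepComp (.handle (.hand T cr h) (.op o v U c))
        (.op o v U (.handle ((Val.hand T cr h).rename Ren.wkTm) c))

end

end ExEff

namespace ExEff

universe u

/-! ### Renaming and substitution in skeletons -/

-- Type safety is preservation together with progress. Preservation (`StepVal.preservation`,
-- `StepComp.preservation`) goes by induction on the step. For congruences and most push rules,
-- inversion of the typing derivation suffices: the head constructor of the coercion determines the
-- form of both sides of its type, hence also the types of its components. The β rules, the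
-- sequencing and handling rules that substitute a value, and the push rules for skeletons, types
-- and dirts rest on stability of typing under substitution (`HasVal.subst`, `HasComp.subst`,
-- `HasCo.subst`).
--
-- Substitution is treated for all five sorts of variables at once. A substitution maps `G` to `G'`
-- (`Subst.Maps`) when each variable of `G` goes to an expression over `G'` of the substituted type,
-- and this property survives passing under a binder (`Subst.Maps.up`). Passing under a binder
-- weakens the images, so stability under renaming has to come first. Types contain neither terms
-- nor coercions, so composition laws are needed only for skeletons, dirts and types. Two further
-- facts enter: `⟨α⟩` turns into the reflexivity coercion of a well-formed type, which is well typed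
-- (`WfVTy.hasCo_reflCo`), and the types in the signature are closed, so no substitution disturbs
-- the typing of operations.
--
-- One rule needs more than shapes. Pushing a cast into an operation call requires `op ∈ Δ₂` when
-- `op ∈ Δ₁` and a coercion proves `Δ₁ ≤ Δ₂`. Without dirt coercion variables such a coercion only
-- ever proves an inclusion of operations (`HasCo.ops_subset`); an assumption `ω : Δ₁ ≤ Δ₂` could
-- claim anything, which is why `Ctx.NoDirtCo` appears. Steps never go under a binder, so the
-- environment stays fixed, and value steps never run a computation, so values do not need the
-- restriction.
--
-- Progress (`HasVal.progress`, `HasComp.progress`) is recursion on the typing derivation with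
-- canonical forms: a result in head position is either the matching abstraction, which allows a β
-- or handler step, or a cast by the matching coercion, which allows a push. A cast by `⟨α⟩` cannot
-- be stuck, since no result has a type variable as its type (`ResVal.not_hasVal_var`). Terminal
-- computations are chains of casts around a `return` (`TermComp.eq_retCasts`), the form consumed by
-- the return rules.

theorem upr_comp (f g : ℕ → ℕ) : upr (g ∘ f) = upr g ∘ upr f := by
  funext n; cases n <;> rfl

theorem upr_id : upr id = id := by
  funext n; cases n <;> rfl

theorem Skel.rename_rename (t : Skel) (f g : ℕ → ℕ) :
    (t.rename f).rename g = t.rename (g ∘ f) := by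
  induction t generalizing f g with
  | all t ih => simp [Skel.rename, ih, upr_comp]
  | _ => simp_all [Skel.rename]

theorem Skel.rename_id (t : Skel) : t.rename id = t := by
  induction t with
  | all t ih => simp [Skel.rename, upr_id, ih]
  | _ => simp_all [Skel.rename]

theorem Skel.ups_comp_upr (f : ℕ → ℕ) (s : ℕ → Skel) :
    Skel.ups s ∘ upr f = Skel.ups (s ∘ f) := by
  funext n; cases n <;> rfl

theorem Skel.rename_subst (t : Skel) (f : ℕ → ℕ) (s : ℕ → Skel) :
    (t.rename f).subst s = t.subst (s ∘ f) := by
  induction t generalizing f s with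
  | all t ih => simp [Skel.rename, Skel.subst, ih, Skel.ups_comp_upr]
  | _ => simp_all [Skel.rename, Skel.subst]

theorem Skel.rename_ups (s : ℕ → Skel) (f : ℕ → ℕ) :
    (fun n => (Skel.ups s n).rename (upr f)) = Skel.ups fun n => (s n).rename f := by
  funext n; cases n with
  | zero => rfl
  | succ n => simp only [Skel.ups, Skel.rename_rename]; rfl

theorem Skel.subst_rename (t : Skel) (s : ℕ → Skel) (f : ℕ → ℕ) :
    (t.subst s).rename f = t.subst fun n => (s n).rename f := by
  induction t generalizing f s with
  | all t ih => simp [Skel.rename, Skel.subst, ih, Skel.rename_ups]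
  | _ => simp_all [Skel.rename, Skel.subst]

/-- At a successor index both sides weaken an image, and the two mixed laws move the weakening past
`s'`. This is why the law for two substitutions comes last. -/
theorem Skel.subst_ups (s s' : ℕ → Skel) :
    (fun n => (Skel.ups s n).subst (Skel.ups s')) = Skel.ups fun n => (s n).subst s' := by
  funext n; cases n with
  | zero => rfl
  | succ n => simp only [Skel.ups, Skel.rename_subst, Skel.subst_rename]; rfl

theorem Skel.subst_subst (t : Skel) (s s' : ℕ → Skel) :
    (t.subst s).subst s' = t.subst fun n => (s n).subst s' := by
  induction t generalizing s s' with
  | all t ih => simp [Skel.subst, ih, Skel.subst_ups]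
  | _ => simp_all [Skel.subst]

theorem Skel.ups_var : Skel.ups Skel.var = Skel.var := by
  funext n; cases n <;> rfl

theorem Skel.subst_var (t : Skel) : t.subst Skel.var = t := by
  induction t with
  | all t ih => simp [Skel.subst, Skel.ups_var, ih]
  | _ => simp_all [Skel.subst]

section
variable {Op : Type u}

/-! ### Renaming and substitution in dirts -/

theorem Dirt.rename_rename (D : Dirt Op) (f g : ℕ → ℕ) :
    (D.rename f).rename g = D.rename (g ∘ f) := by
  simp [Dirt.rename]

theorem Dirt.rename_id (D : Dirt Op) : D.rename id = D := by
  simp [Dirt.rename]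

section
variable [DecidableEq Op]

theorem Dirt.rename_subst (D : Dirt Op) (f : ℕ → ℕ) (s : ℕ → Dirt Op) :
    (D.rename f).subst s = D.subst (s ∘ f) := by
  rcases D with ⟨O, _ | n⟩ <;> simp [Dirt.rename, Dirt.subst]

theorem Dirt.subst_rename (D : Dirt Op) (s : ℕ → Dirt Op) (f : ℕ → ℕ) :
    (D.subst s).rename f = D.subst fun n => (s n).rename f := by
  rcases D with ⟨O, _ | n⟩ <;> simp [Dirt.rename, Dirt.subst, Dirt.addOps]

/-- A dirt ends in at most one variable, so the two substitutions only collect nested unions of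
operations. -/
theorem Dirt.subst_subst (D : Dirt Op) (s s' : ℕ → Dirt Op) :
    (D.subst s).subst s' = D.subst fun n => (s n).subst s' := by
  rcases D with ⟨O, _ | n⟩
  · simp [Dirt.subst]
  · rcases h : s n with ⟨O', _ | m⟩ <;> simp [Dirt.subst, Dirt.addOps, h, Finset.union_assoc]

theorem Dirt.subst_var (D : Dirt Op) : D.subst Dirt.var = D := by
  rcases D with ⟨O, _ | n⟩ <;> simp [Dirt.subst, Dirt.addOps, Dirt.var]

theorem Dirt.var_subst (n : ℕ) (s : ℕ → Dirt Op) : (Dirt.var n).subst s = s n := by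
  simp [Dirt.subst, Dirt.addOps, Dirt.var]

theorem Dirt.cons_subst (o : Op) (D : Dirt Op) (s : ℕ → Dirt Op) :
    (D.cons o).subst s = (D.subst s).cons o := by
  rcases D with ⟨O, _ | n⟩ <;> simp [Dirt.subst, Dirt.addOps, Dirt.cons]

theorem Dirt.addOps_subst (D : Dirt Op) (O : Finset Op) (s : ℕ → Dirt Op) :
    (D.addOps O).subst s = (D.subst s).addOps O := by
  rcases D with ⟨O, _ | n⟩ <;> simp [Dirt.subst, Dirt.addOps]

end

/-! ### Composition of type-level renamings and substitutions -/

@[ext] theorem TySub.ext {s s' : TySub Op} (hs : ∀ n, s.sk n = s'.sk n)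
    (ht : ∀ n, s.ty n = s'.ty n) (hd : ∀ n, s.di n = s'.di n) : s = s' := by
  cases s; cases s'; simp only [TySub.mk.injEq]; exact ⟨funext hs, funext ht, funext hd⟩

/-- First `r`, then `r'`. -/
def TyRen.comp (r r' : TyRen) : TyRen := ⟨r'.sk ∘ r.sk, r'.ty ∘ r.ty, r'.di ∘ r.di⟩

/-- First the renaming `r`, then the substitution `s`. -/
def TyRen.thenSub (r : TyRen) (s : TySub Op) : TySub Op := ⟨s.sk ∘ r.sk, s.ty ∘ r.ty, s.di ∘ r.di⟩

/-- First the substitution `s`, then the renaming `r`. -/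
def TySub.thenRen (s : TySub Op) (r : TyRen) : TySub Op :=
  ⟨fun n => (s.sk n).rename r.sk, fun n => (s.ty n).rename r, fun n => (s.di n).rename r.di⟩

/-- First `s`, then `s'`. -/
def TySub.comp [DecidableEq Op] (s s' : TySub Op) : TySub Op :=
  ⟨fun n => (s.sk n).subst s'.sk, fun n => (s.ty n).subst s', fun n => (s.di n).subst s'.di⟩

theorem TyRen.upSk_comp (r r' : TyRen) : (r.comp r').upSk = r.upSk.comp r'.upSk := by
  simp [TyRen.comp, TyRen.upSk, upr_comp]

theorem TyRen.upTy_comp (r r' : TyRen) : (r.comp r').upTy = r.upTy.comp r'.upTy := by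
  simp [TyRen.comp, TyRen.upTy, upr_comp]

theorem TyRen.upDi_comp (r r' : TyRen) : (r.comp r').upDi = r.upDi.comp r'.upDi := by
  simp [TyRen.comp, TyRen.upDi, upr_comp]

theorem TyRen.upSk_ident : TyRen.ident.upSk = TyRen.ident := by
  simp [TyRen.ident, TyRen.upSk, upr_id]

theorem TyRen.upTy_ident : TyRen.ident.upTy = TyRen.ident := by
  simp [TyRen.ident, TyRen.upTy, upr_id]

theorem TyRen.upDi_ident : TyRen.ident.upDi = TyRen.ident := by
  simp [TyRen.ident, TyRen.upDi, upr_id]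

/-! ### Renaming and substitution in types -/

mutual
theorem VTy.rename_rename (r r' : TyRen) :
    ∀ T : VTy Op, (T.rename r).rename r' = T.rename (r.comp r')
  | .var n => by simp [VTy.rename, TyRen.comp]
  | .unit => by simp [VTy.rename]
  | .arr T C => by simp [VTy.rename, VTy.rename_rename r r' T, CTy.rename_rename r r' C]
  | .hnd C D => by simp [VTy.rename, CTy.rename_rename r r' C, CTy.rename_rename r r' D]
  | .allSk T => by simp [VTy.rename, VTy.rename_rename _ _ T, TyRen.upSk_comp]
  | .allTy t T => by
    simp [VTy.rename, VTy.rename_rename _ _ T, TyRen.upTy_comp, Skel.rename_rename]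
    rfl
  | .allDi T => by simp [VTy.rename, VTy.rename_rename _ _ T, TyRen.upDi_comp]
  | .qual p T => by simp [VTy.rename, SCt.rename_rename r r' p, VTy.rename_rename r r' T]
theorem CTy.rename_rename (r r' : TyRen) :
    ∀ C : CTy Op, (C.rename r).rename r' = C.rename (r.comp r')
  | .mk T D => by
    simp [CTy.rename, VTy.rename_rename r r' T, Dirt.rename_rename]; rfl
theorem SCt.rename_rename (r r' : TyRen) :
    ∀ p : SCt Op, (p.rename r).rename r' = p.rename (r.comp r')
  | .vle T1 T2 => by simp [SCt.rename, VTy.rename_rename r r' T1, VTy.rename_rename r r' T2]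
  | .dle D1 D2 => by simp [SCt.rename, Dirt.rename_rename]; exact ⟨rfl, rfl⟩
end

mutual
theorem VTy.rename_ident : ∀ T : VTy Op, T.rename TyRen.ident = T
  | .var n => by simp [VTy.rename, TyRen.ident]
  | .unit => by simp [VTy.rename]
  | .arr T C => by simp [VTy.rename, VTy.rename_ident T, CTy.rename_ident C]
  | .hnd C D => by simp [VTy.rename, CTy.rename_ident C, CTy.rename_ident D]
  | .allSk T => by simp [VTy.rename, TyRen.upSk_ident, VTy.rename_ident T]
  | .allTy t T => by
    simp only [VTy.rename, TyRen.upTy_ident, VTy.rename_ident T]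
    exact congrArg (VTy.allTy · T) t.rename_id
  | .allDi T => by simp [VTy.rename, TyRen.upDi_ident, VTy.rename_ident T]
  | .qual p T => by simp [VTy.rename, SCt.rename_ident p, VTy.rename_ident T]
theorem CTy.rename_ident : ∀ C : CTy Op, C.rename TyRen.ident = C
  | .mk T D => by
    simp only [CTy.rename, VTy.rename_ident T]
    exact congrArg (CTy.mk T) D.rename_id
theorem SCt.rename_ident : ∀ p : SCt Op, p.rename TyRen.ident = p
  | .vle T1 T2 => by simp [SCt.rename, VTy.rename_ident T1, VTy.rename_ident T2]
  | .dle D1 D2 => congrArg₂ SCt.dle D1.rename_id D2.rename_id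
end

theorem TyRen.upSk_thenSub (r : TyRen) (s : TySub Op) :
    r.upSk.thenSub s.upSk = (r.thenSub s).upSk := by
  ext n
  · cases n <;> rfl
  all_goals rfl

theorem TyRen.upTy_thenSub (r : TyRen) (s : TySub Op) :
    r.upTy.thenSub s.upTy = (r.thenSub s).upTy := by
  ext n
  · rfl
  · cases n <;> rfl
  · rfl

theorem TyRen.upDi_thenSub (r : TyRen) (s : TySub Op) :
    r.upDi.thenSub s.upDi = (r.thenSub s).upDi := by
  ext n
  · rfl
  · rfl
  · cases n <;> rfl

theorem TySub.upSk_thenRen (s : TySub Op) (r : TyRen) :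
    s.upSk.thenRen r.upSk = (s.thenRen r).upSk := by
  ext n
  · exact congrFun (Skel.rename_ups s.sk r.sk) n
  · simp only [TySub.thenRen, TySub.upSk, VTy.rename_rename]; rfl
  · rfl

theorem TySub.upTy_thenRen (s : TySub Op) (r : TyRen) :
    s.upTy.thenRen r.upTy = (s.thenRen r).upTy := by
  ext n
  · rfl
  · cases n with
    | zero => simp [TySub.thenRen, TySub.upTy, scons, VTy.rename, TyRen.upTy, upr]
    | succ n => simp only [TySub.thenRen, TySub.upTy, scons, VTy.rename_rename]; rfl
  · rfl

theorem TySub.upDi_thenRen (s : TySub Op) (r : TyRen) :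
    s.upDi.thenRen r.upDi = (s.thenRen r).upDi := by
  ext n
  · rfl
  · simp only [TySub.thenRen, TySub.upDi, VTy.rename_rename]; rfl
  · cases n with
    | zero => rfl
    | succ n => simp only [TySub.thenRen, TySub.upDi, scons, Dirt.rename_rename]; rfl

theorem TySub.upSk_ident : (TySub.ident : TySub Op).upSk = TySub.ident := by
  ext n
  · exact congrFun Skel.ups_var n
  all_goals rfl

theorem TySub.upTy_ident : (TySub.ident : TySub Op).upTy = TySub.ident := by
  ext n
  · rfl
  · cases n <;> rfl
  · rfl

theorem TySub.upDi_ident : (TySub.ident : TySub Op).upDi = TySub.ident := by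
  ext n
  · rfl
  · rfl
  · cases n <;> rfl

section
variable [DecidableEq Op]

mutual
theorem VTy.rename_subst (r : TyRen) (s : TySub Op) :
    ∀ T : VTy Op, (T.rename r).subst s = T.subst (r.thenSub s)
  | .var n => by simp [VTy.rename, VTy.subst, TyRen.thenSub]
  | .unit => by simp [VTy.rename, VTy.subst]
  | .arr T C => by
    simp [VTy.rename, VTy.subst, VTy.rename_subst r s T, CTy.rename_subst r s C]
  | .hnd C D => by
    simp [VTy.rename, VTy.subst, CTy.rename_subst r s C, CTy.rename_subst r s D]
  | .allSk T => by
    simp [VTy.rename, VTy.subst, VTy.rename_subst _ _ T, TyRen.upSk_thenSub]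
  | .allTy t T => by
    simp [VTy.rename, VTy.subst, VTy.rename_subst _ _ T, TyRen.upTy_thenSub, Skel.rename_subst]
    rfl
  | .allDi T => by
    simp [VTy.rename, VTy.subst, VTy.rename_subst _ _ T, TyRen.upDi_thenSub]
  | .qual p T => by
    simp [VTy.rename, VTy.subst, SCt.rename_subst r s p, VTy.rename_subst r s T]
theorem CTy.rename_subst (r : TyRen) (s : TySub Op) :
    ∀ C : CTy Op, (C.rename r).subst s = C.subst (r.thenSub s)
  | .mk T D => by
    simp [CTy.rename, CTy.subst, VTy.rename_subst r s T, Dirt.rename_subst]; rfl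
theorem SCt.rename_subst (r : TyRen) (s : TySub Op) :
    ∀ p : SCt Op, (p.rename r).subst s = p.subst (r.thenSub s)
  | .vle T1 T2 => by
    simp [SCt.rename, SCt.subst, VTy.rename_subst r s T1, VTy.rename_subst r s T2]
  | .dle D1 D2 => by
    simp [SCt.rename, SCt.subst, Dirt.rename_subst]; exact ⟨rfl, rfl⟩
end

mutual
theorem VTy.subst_rename (s : TySub Op) (r : TyRen) :
    ∀ T : VTy Op, (T.subst s).rename r = T.subst (s.thenRen r)
  | .var n => by simp [VTy.subst, TySub.thenRen]
  | .unit => by simp [VTy.rename, VTy.subst]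
  | .arr T C => by
    simp [VTy.rename, VTy.subst, VTy.subst_rename s r T, CTy.subst_rename s r C]
  | .hnd C D => by
    simp [VTy.rename, VTy.subst, CTy.subst_rename s r C, CTy.subst_rename s r D]
  | .allSk T => by
    simp [VTy.rename, VTy.subst, VTy.subst_rename _ _ T, TySub.upSk_thenRen]
  | .allTy t T => by
    simp [VTy.rename, VTy.subst, VTy.subst_rename _ _ T, TySub.upTy_thenRen, Skel.subst_rename]
    rfl
  | .allDi T => by
    simp [VTy.rename, VTy.subst, VTy.subst_rename _ _ T, TySub.upDi_thenRen]
  | .qual p T => by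
    simp [VTy.rename, VTy.subst, SCt.subst_rename s r p, VTy.subst_rename s r T]
theorem CTy.subst_rename (s : TySub Op) (r : TyRen) :
    ∀ C : CTy Op, (C.subst s).rename r = C.subst (s.thenRen r)
  | .mk T D => by
    simp [CTy.rename, CTy.subst, VTy.subst_rename s r T, Dirt.subst_rename]; rfl
theorem SCt.subst_rename (s : TySub Op) (r : TyRen) :
    ∀ p : SCt Op, (p.subst s).rename r = p.subst (s.thenRen r)
  | .vle T1 T2 => by
    simp [SCt.rename, SCt.subst, VTy.subst_rename s r T1, VTy.subst_rename s r T2]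
  | .dle D1 D2 => by
    simp [SCt.rename, SCt.subst, Dirt.subst_rename]; exact ⟨rfl, rfl⟩
end

theorem TySub.upSk_comp (s s' : TySub Op) : s.upSk.comp s'.upSk = (s.comp s').upSk := by
  ext n
  · exact congrFun (Skel.subst_ups s.sk s'.sk) n
  · simp only [TySub.comp, TySub.upSk, VTy.rename_subst, VTy.subst_rename]
    -- Both sides weaken the images of `s'`; they differ only in that one also renames the dirts, by
    -- the identity.
    congr 1
    ext n
    · rfl
    · rfl
    · exact (Dirt.rename_id _).symm
  · rfl

theorem TySub.upTy_comp (s s' : TySub Op) : s.upTy.comp s'.upTy = (s.comp s').upTy := by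
  ext n
  · rfl
  · cases n with
    | zero => simp [TySub.comp, TySub.upTy, scons, VTy.subst]
    | succ n =>
      simp only [TySub.comp, TySub.upTy, scons, VTy.rename_subst, VTy.subst_rename]
      congr 1
      ext n
      · exact (Skel.rename_id _).symm
      · rfl
      · exact (Dirt.rename_id _).symm
  · rfl

theorem TySub.upDi_comp (s s' : TySub Op) : s.upDi.comp s'.upDi = (s.comp s').upDi := by
  ext n
  · rfl
  · simp only [TySub.comp, TySub.upDi, VTy.rename_subst, VTy.subst_rename]
    congr 1
    ext n
    · exact (Skel.rename_id _).symm
    · rfl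
    · rfl
  · cases n with
    | zero => exact Dirt.var_subst _ _
    | succ n => simp only [TySub.comp, TySub.upDi, scons, Dirt.rename_subst, Dirt.subst_rename]; rfl

mutual
theorem VTy.subst_subst (s s' : TySub Op) :
    ∀ T : VTy Op, (T.subst s).subst s' = T.subst (s.comp s')
  | .var n => by simp [VTy.subst, TySub.comp]
  | .unit => by simp [VTy.subst]
  | .arr T C => by simp [VTy.subst, VTy.subst_subst s s' T, CTy.subst_subst s s' C]
  | .hnd C D => by simp [VTy.subst, CTy.subst_subst s s' C, CTy.subst_subst s s' D]
  | .allSk T => by simp [VTy.subst, VTy.subst_subst _ _ T, TySub.upSk_comp]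
  | .allTy t T => by
    simp [VTy.subst, VTy.subst_subst _ _ T, TySub.upTy_comp, Skel.subst_subst]
    rfl
  | .allDi T => by simp [VTy.subst, VTy.subst_subst _ _ T, TySub.upDi_comp]
  | .qual p T => by simp [VTy.subst, SCt.subst_subst s s' p, VTy.subst_subst s s' T]
theorem CTy.subst_subst (s s' : TySub Op) :
    ∀ C : CTy Op, (C.subst s).subst s' = C.subst (s.comp s')
  | .mk T D => by
    simp [CTy.subst, VTy.subst_subst s s' T, Dirt.subst_subst]; rfl
theorem SCt.subst_subst (s s' : TySub Op) :
    ∀ p : SCt Op, (p.subst s).subst s' = p.subst (s.comp s')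
  | .vle T1 T2 => by simp [SCt.subst, VTy.subst_subst s s' T1, VTy.subst_subst s s' T2]
  | .dle D1 D2 => by simp [SCt.subst, Dirt.subst_subst]; exact ⟨rfl, rfl⟩
end

mutual
theorem VTy.subst_ident : ∀ T : VTy Op, T.subst TySub.ident = T
  | .var n => by simp [VTy.subst, TySub.ident]
  | .unit => by simp [VTy.subst]
  | .arr T C => by simp [VTy.subst, VTy.subst_ident T, CTy.subst_ident C]
  | .hnd C D => by simp [VTy.subst, CTy.subst_ident C, CTy.subst_ident D]
  | .allSk T => by simp [VTy.subst, TySub.upSk_ident, VTy.subst_ident T]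
  | .allTy t T => by
    simp only [VTy.subst, TySub.upTy_ident, VTy.subst_ident T]
    exact congrArg (VTy.allTy · T) t.subst_var
  | .allDi T => by simp [VTy.subst, TySub.upDi_ident, VTy.subst_ident T]
  | .qual p T => by simp [VTy.subst, SCt.subst_ident p, VTy.subst_ident T]
theorem CTy.subst_ident : ∀ C : CTy Op, C.subst TySub.ident = C
  | .mk T D => by
    simp only [CTy.subst, VTy.subst_ident T]
    exact congrArg (CTy.mk T) D.subst_var
theorem SCt.subst_ident : ∀ p : SCt Op, p.subst TySub.ident = p
  | .vle T1 T2 => by simp [SCt.subst, VTy.subst_ident T1, VTy.subst_ident T2]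
  | .dle D1 D2 => congrArg₂ SCt.dle D1.subst_var D2.subst_var
end

/-- Closedness speaks of substitutions only; a renaming followed by the identity substitution is
one. -/
theorem VTy.Closed.rename {A : VTy Op} (hA : A.Closed) (r : TyRen) : A.rename r = A := by
  rw [← VTy.subst_ident (A.rename r), VTy.rename_subst, hA]

theorem VTy.Closed.subst {A : VTy Op} (hA : A.Closed) (s : TySub Op) : A.subst s = A := hA s

/-! ### Instantiations commute with renamings and substitutions -/

/-- The type of an application to a skeleton is an instantiation, so renaming its typing derivation
needs this commutation. The versions for types and dirts serve the other two applications. -/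
theorem VTy.instSk_rename (T : VTy Op) (t : Skel) (r : TyRen) :
    (T.subst (.instSk t)).rename r = (T.rename r.upSk).subst (.instSk (t.rename r.sk)) := by
  rw [VTy.subst_rename, VTy.rename_subst]
  congr 1
  ext n
  · cases n <;> rfl
  · simp [TySub.thenRen, TyRen.thenSub, TySub.instSk, TySub.ident, TyRen.upSk, VTy.rename]
  · rfl

theorem VTy.instTy_rename (T U : VTy Op) (r : TyRen) :
    (T.subst (.instTy U)).rename r = (T.rename r.upTy).subst (.instTy (U.rename r)) := by
  rw [VTy.subst_rename, VTy.rename_subst]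
  congr 1
  ext n
  · rfl
  · cases n <;>
      simp [TySub.thenRen, TyRen.thenSub, TySub.instTy, TyRen.upTy, VTy.rename, scons, upr]
  · rfl

theorem VTy.instDi_rename (T : VTy Op) (D : Dirt Op) (r : TyRen) :
    (T.subst (.instDi D)).rename r = (T.rename r.upDi).subst (.instDi (D.rename r.di)) := by
  rw [VTy.subst_rename, VTy.rename_subst]
  congr 1
  ext n
  · rfl
  · simp [TySub.thenRen, TyRen.thenSub, TySub.instDi, TySub.ident, TyRen.upDi, VTy.rename]
  · cases n <;> rfl

/-- The index `0` is immediate. At the other indices `upSk` weakens an image and the instantiation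
then undoes the weakening, which leaves the identity substitution. The versions for types and dirts
work in the same way. -/
theorem VTy.instSk_subst (T : VTy Op) (t : Skel) (s : TySub Op) :
    (T.subst (.instSk t)).subst s = (T.subst s.upSk).subst (.instSk (t.subst s.sk)) := by
  rw [VTy.subst_subst, VTy.subst_subst]
  congr 1
  ext n
  · cases n with
    | zero => rfl
    | succ n =>
      simp only [TySub.comp, TySub.upSk, Skel.ups, Skel.rename_subst]
      exact (Skel.subst_var _).symm
  · simp only [TySub.comp, TySub.upSk, VTy.rename_subst]
    exact (VTy.subst.eq_1 s n).trans (VTy.subst_ident _).symm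
  · exact (Dirt.var_subst _ _).trans (Dirt.subst_var _).symm

theorem VTy.instTy_subst (T U : VTy Op) (s : TySub Op) :
    (T.subst (.instTy U)).subst s = (T.subst s.upTy).subst (.instTy (U.subst s)) := by
  rw [VTy.subst_subst, VTy.subst_subst]
  congr 1
  ext n
  · exact (Skel.subst_var _).symm
  · cases n with
    | zero => simp [TySub.comp, TySub.instTy, TySub.upTy, scons, VTy.subst]
    | succ n =>
      simp only [TySub.comp, TySub.upTy, scons, VTy.rename_subst]
      exact (VTy.subst.eq_1 s n).trans (VTy.subst_ident _).symm
  · exact (Dirt.var_subst _ _).trans (Dirt.subst_var _).symm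

theorem VTy.instDi_subst (T : VTy Op) (D : Dirt Op) (s : TySub Op) :
    (T.subst (.instDi D)).subst s = (T.subst s.upDi).subst (.instDi (D.subst s.di)) := by
  rw [VTy.subst_subst, VTy.subst_subst]
  congr 1
  ext n
  · exact (Skel.subst_var _).symm
  · simp only [TySub.comp, TySub.upDi, VTy.rename_subst]
    exact (VTy.subst.eq_1 s n).trans (VTy.subst_ident _).symm
  · cases n with
    | zero => exact (Dirt.var_subst _ _).symm
    | succ n =>
      simp only [TySub.comp, TySub.upDi, scons, Dirt.rename_subst]
      exact (Dirt.var_subst _ _).trans (Dirt.subst_var _).symm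

end

end

section
variable {Op : Type u}

/-! ### Renamings between environments -/

def FCt.rename (r : TyRen) : FCt Op → FCt Op
  | .simple p => .simple (p.rename r)
  | .cle C1 C2 => .cle (C1.rename r) (C2.rename r)

def FCt.subst [DecidableEq Op] (s : TySub Op) : FCt Op → FCt Op
  | .simple p => .simple (p.subst s)
  | .cle C1 C2 => .cle (C1.subst s) (C2.subst s)

def Binding.rename (r : TyRen) : Binding Op → Binding Op
  | .sk => .sk
  | .ty t => .ty (t.rename r.sk)
  | .di => .di
  | .tm T => .tm (T.rename r)
  | .co p => .co (p.rename r)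

def Binding.subst [DecidableEq Op] (s : TySub Op) : Binding Op → Binding Op
  | .sk => .sk
  | .ty t => .ty (t.subst s.sk)
  | .di => .di
  | .tm T => .tm (T.subst s)
  | .co p => .co (p.subst s)

/-- The extension of a renaming under an entry of an environment. -/
def Ren.up (r : Ren) : Binding Op → Ren
  | .sk => r.upSk
  | .ty _ => r.upTy
  | .di => r.upDi
  | .tm _ => r.upTm
  | .co _ => r.upCo

/-- The extension of a substitution under an entry of an environment. -/
def Subst.up (s : Subst Op) : Binding Op → Subst Op
  | .sk => s.upSk
  | .ty _ => s.upTy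
  | .di => s.upDi
  | .tm _ => s.upTm
  | .co _ => s.upCo

/-- `r` renames the variables of `G` to variables of `G'` with the renamed types. -/
structure Ren.Maps (r : Ren) (G G' : Ctx Op) : Prop where
  sk {n : ℕ} : LookSk G n → LookSk G' (r.sk n)
  ty {n : ℕ} {t : Skel} : LookTy G n t → LookTy G' (r.ty n) (t.rename r.sk)
  di {n : ℕ} : LookDi G n → LookDi G' (r.di n)
  co {n : ℕ} {p : SCt Op} : LookCo G n p → LookCo G' (r.co n) (p.rename r.toTyRen)
  tm {n : ℕ} {T : VTy Op} : LookTm G n T → LookTm G' (r.tm n) (T.rename r.toTyRen)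

theorem Ren.maps_wk (b : Binding Op) (G : Ctx Op) : b.wk.Maps G (b :: G) :=
  ⟨.there b, .there b, .there b, .there b, .there b⟩

/-- Naturality of weakening: it lets an older entry of the environment be transported before or
after the new entry is added. -/
theorem Ren.wk_comp_up (r : Ren) (b : Binding Op) :
    b.wk.toTyRen.comp (r.up b).toTyRen = r.toTyRen.comp (b.rename r.toTyRen).wk.toTyRen := by
  cases b <;> rfl

theorem Ren.Maps.up {r : Ren} {G G' : Ctx Op} (hr : r.Maps G G') (b : Binding Op) :
    (r.up b).Maps (b :: G) (b.rename r.toTyRen :: G') where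
  sk h := by
    cases h with
    | here => exact .here
    | there b h =>
      have := LookSk.there (b.rename r.toTyRen) (hr.sk h)
      cases b <;> exact this
  ty h := by
    cases h with
    | here => exact .here
    | there b h =>
      have := LookTy.there (b.rename r.toTyRen) (hr.ty h)
      rw [Skel.rename_rename] at this ⊢
      cases b <;> exact this
  di h := by
    cases h with
    | here => exact .here
    | there b h =>
      have := LookDi.there (b.rename r.toTyRen) (hr.di h)
      cases b <;> exact this
  co h := by
    cases h with
    | here => exact .here
    | there b h =>
      have := LookCo.there (b.rename r.toTyRen) (hr.co h)
      rw [SCt.rename_rename, ← Ren.wk_comp_up] at this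
      rw [SCt.rename_rename]
      cases b <;> exact this
  tm h := by
    cases h with
    | here => exact .here
    | there b h =>
      have := LookTm.there (b.rename r.toTyRen) (hr.tm h)
      rw [VTy.rename_rename, ← Ren.wk_comp_up] at this
      rw [VTy.rename_rename]
      cases b <;> exact this

-- Identity renamings, lists of clauses and skeletons

theorem Co.rename_ident (g : Co Op) : g.rename TyRen.ident id = g := by
  induction g with
  | var n => rfl
  | tyRefl n => rfl
  | diRefl D => exact congrArg Co.diRefl D.rename_id
  | empty D => exact congrArg Co.empty D.rename_id
  | allSk g ih => simp [Co.rename, TyRen.upSk_ident, ih]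
  | allTy t g ih =>
    simp only [Co.rename, TyRen.upTy_ident, ih]
    exact congrArg (Co.allTy · g) t.rename_id
  | allDi g ih => simp [Co.rename, TyRen.upDi_ident, ih]
  | qual p g ih => simp [Co.rename, SCt.rename_ident, ih]
  | _ => simp_all [Co.rename]

theorem FCt.rename_ident (q : FCt Op) : q.rename TyRen.ident = q := by
  cases q <;> simp [FCt.rename, SCt.rename_ident, CTy.rename_ident]

theorem Clauses.opList_rename (r : Ren) : ∀ h : Clauses Op, (h.rename r).opList = h.opList
  | .nil => by simp [Clauses.rename]
  | .cons o c h => by simp [Clauses.rename, Clauses.opList, Clauses.opList_rename r h]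

theorem WfSkel.rename {G : Ctx Op} {t : Skel} (h : WfSkel G t) :
    ∀ {r : Ren} {G' : Ctx Op}, r.Maps G G' → WfSkel G' (t.rename r.sk) := by
  induction h with
  | var h => exact fun hr => .var (hr.sk h)
  | unit => exact fun _ => .unit
  | arr _ _ ih1 ih2 => exact fun hr => .arr (ih1 hr) (ih2 hr)
  | hnd _ _ ih1 ih2 => exact fun hr => .hnd (ih1 hr) (ih2 hr)
  | all _ ih => exact fun hr => .all (ih (hr.up .sk))

theorem TySub.thenRen_ident (s : TySub Op) : s.thenRen TyRen.ident = s := by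
  ext n
  · exact Skel.rename_id _
  · exact VTy.rename_ident _
  · exact Dirt.rename_id _

section
variable [DecidableEq Op]

theorem Clauses.opList_subst (s : Subst Op) : ∀ h : Clauses Op, (h.subst s).opList = h.opList
  | .nil => by simp [Clauses.subst]
  | .cons o c h => by simp [Clauses.subst, Clauses.opList, Clauses.opList_subst s h]

variable {S : Sig Op}

/-! ### Typing is stable under renaming -/

theorem WfDirt.rename {G : Ctx Op} {D : Dirt Op} (h : WfDirt S G D) {r : Ren} {G' : Ctx Op}
    (hr : r.Maps G G') : WfDirt S G' (D.rename r.di) := by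
  induction h with
  | nil => exact .nil
  | var h => exact .var (hr.di h)
  | cons hS _ ih => exact .cons hS ih

mutual
theorem WfVTy.rename {G : Ctx Op} {T : VTy Op} {t : Skel} {r : Ren} {G' : Ctx Op}
    (hr : r.Maps G G') : WfVTy S G T t → WfVTy S G' (T.rename r.toTyRen) (t.rename r.sk)
  | .var h => .var (hr.ty h)
  | .unit => .unit
  | .arr h1 h2 => .arr (h1.rename hr) (h2.rename hr)
  | .hnd h1 h2 => .hnd (h1.rename hr) (h2.rename hr)
  | .qual h1 h2 => .qual (h1.rename hr) (h2.rename hr)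
  | .allSk h => .allSk (h.rename (hr.up .sk))
  | .allTy h => .allTy (h.rename (hr.up (.ty _)))
  | .allDi h => .allDi (h.rename (hr.up .di))
theorem WfCTy.rename {G : Ctx Op} {C : CTy Op} {t : Skel} {r : Ren} {G' : Ctx Op}
    (hr : r.Maps G G') : WfCTy S G C t → WfCTy S G' (C.rename r.toTyRen) (t.rename r.sk)
  | .mk h1 h2 => .mk (h1.rename hr) (h2.rename hr)
theorem WfSCt.rename {G : Ctx Op} {p : SCt Op} {r : Ren} {G' : Ctx Op}
    (hr : r.Maps G G') : WfSCt S G p → WfSCt S G' (p.rename r.toTyRen)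
  | .vle h1 h2 => .vle (h1.rename hr) (h2.rename hr)
  | .dle h1 h2 => .dle (h1.rename hr) (h2.rename hr)
end

theorem HasCo.rename {G : Ctx Op} {g : Co Op} {q : FCt Op} (h : HasCo S G g q) :
    ∀ {r : Ren} {G' : Ctx Op}, r.Maps G G' →
      HasCo S G' (g.rename r.toTyRen r.co) (q.rename r.toTyRen) := by
  induction h with
  | var h => exact fun hr => .var (hr.co h)
  | tyRefl h => exact fun hr => .tyRefl (h.rename hr)
  | diRefl h => exact fun hr => .diRefl (h.rename hr)
  | unitRefl => exact fun _ => .unitRefl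
  | arr _ _ ih1 ih2 => exact fun hr => .arr (ih1 hr) (ih2 hr)
  | hnd _ _ ih1 ih2 => exact fun hr => .hnd (ih1 hr) (ih2 hr)
  | allSk _ ih => exact fun hr => .allSk (ih (hr.up .sk))
  | allTy _ ih => exact fun hr => .allTy (ih (hr.up (.ty _)))
  | allDi _ ih => exact fun hr => .allDi (ih (hr.up .di))
  | qual _ h ih => exact fun hr => .qual (ih hr) (h.rename hr)
  | empty h => exact fun hr => .empty (h.rename hr)
  | comp _ _ ih1 ih2 => exact fun hr => .comp (ih1 hr) (ih2 hr)
  | insert _ hS ih => exact fun hr => .insert (ih hr) hS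

/-- Coercions and their types contain no term variables, so this weakening acts as the identity. It
is needed where a cast moves under the binder of a continuation. -/
theorem HasCo.weakenTm {G : Ctx Op} {g : Co Op} {q : FCt Op} (h : HasCo S G g q) (T : VTy Op) :
    HasCo S (.tm T :: G) g q := by
  have := h.rename (Ren.maps_wk (.tm T) G)
  rw [← g.rename_ident, ← q.rename_ident]
  exact this

mutual
theorem HasVal.rename (hS : S.WF) {G : Ctx Op} {v : Val Op} {T : VTy Op} {r : Ren} {G' : Ctx Op}
    (hr : r.Maps G G') : HasVal S G v T → HasVal S G' (v.rename r) (T.rename r.toTyRen)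
  | .var h => .var (hr.tm h)
  | .unit => .unit
  | .lam h hT => .lam (h.rename hS (hr.up (.tm _))) (hT.rename hr)
  | .cast h hg => .cast (h.rename hS hr) (hg.rename hr)
  | .skLam h => .skLam (h.rename hS (hr.up .sk))
  | .tyLam h => .tyLam (h.rename hS (hr.up (.ty _)))
  | .diLam h => .diLam (h.rename hS (hr.up .di))
  | .coLam h hp => .coLam (h.rename hS (hr.up (.co _))) (hp.rename hr)
  | .coApp h hg => .coApp (h.rename hS hr) (hg.rename hr)
  | .hand (h := cl) hc hn hcl => by
    -- The handled operations occur in the type of the handler, and renaming does not change them.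
    have hn' : (cl.rename r).opList.Nodup := (Clauses.opList_rename r cl).symm ▸ hn
    have hcl' := hcl.rename hS hr
    have := HasVal.hand (h := cl.rename r) (T := VTy.rename r.toTyRen _)
      (D := Dirt.rename r.di _) (hc.rename hS (hr.up (.tm _))) hn' hcl'
    rw [Clauses.opList_rename] at this
    exact this
  | .skApp h ht => by
    rw [VTy.instSk_rename]
    exact .skApp (h.rename hS hr) (ht.rename hr)
  | .tyApp h ht => by
    rw [VTy.instTy_rename]
    exact .tyApp (h.rename hS hr) (ht.rename hr)
  | .diApp h ht => by
    rw [VTy.instDi_rename]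
    exact .diApp (h.rename hS hr) (ht.rename hr)
theorem HasComp.rename (hS : S.WF) {G : Ctx Op} {c : Comp Op} {C : CTy Op} {r : Ren}
    {G' : Ctx Op} (hr : r.Maps G G') :
    HasComp S G c C → HasComp S G' (c.rename r) (C.rename r.toTyRen)
  | .app h1 h2 => .app (h1.rename hS hr) (h2.rename hS hr)
  | .letv h1 h2 => .letv (h1.rename hS hr) (h2.rename hS (hr.up (.tm _)))
  | .ret h => .ret (h.rename hS hr)
  | .bind h1 h2 => .bind (h1.rename hS hr) (h2.rename hS (hr.up (.tm _)))
  | .op (A := A) (B := B) ho hv hc hD => by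
    have hv' := hv.rename hS hr
    have hc' := hc.rename hS (hr.up (.tm _))
    -- The types of the operation are closed, so the renamed premises still have the types required
    -- by the signature.
    simp only [Binding.rename, (hS _ _ _ ho).1.1.rename, (hS _ _ _ ho).2.1.rename] at hv' hc'
    simp only [Comp.rename, (hS _ _ _ ho).2.1.rename]
    exact .op ho hv' hc' hD
  | .handle h1 h2 => .handle (h1.rename hS hr) (h2.rename hS hr)
  | .cast h hg => .cast (h.rename hS hr) (hg.rename hr)
theorem HasClauses.rename (hS : S.WF) {G : Ctx Op} {h : Clauses Op} {T : VTy Op} {D : Dirt Op}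
    {r : Ren} {G' : Ctx Op} (hr : r.Maps G G') :
    HasClauses S G h T D → HasClauses S G' (h.rename r) (T.rename r.toTyRen) (D.rename r.di)
  | .nil => .nil
  | .cons ho hc hcl => by
    have hc' := hc.rename hS ((hr.up (.tm _)).up (.tm _))
    simp only [Binding.rename, VTy.rename, Ren.up, Ren.upTm, (hS _ _ _ ho).1.1.rename,
      (hS _ _ _ ho).2.1.rename] at hc'
    exact .cons ho hc' (hcl.rename hS hr)
end

/-! ### Substitutions between environments -/

/-- `s` sends the variables of `G` to expressions over `G'` with the substituted types. -/
structure Subst.Maps (S : Sig Op) (s : Subst Op) (G G' : Ctx Op) : Prop where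
  sk {n : ℕ} : LookSk G n → WfSkel G' (s.sk n)
  ty {n : ℕ} {t : Skel} : LookTy G n t → WfVTy S G' (s.ty n) (t.subst s.sk)
  di {n : ℕ} : LookDi G n → WfDirt S G' (s.di n)
  co {n : ℕ} {p : SCt Op} : LookCo G n p → HasCo S G' (s.co n) (.simple (p.subst s.toTySub))
  tm {n : ℕ} {T : VTy Op} : LookTm G n T → HasVal S G' (s.tm n) (T.subst s.toTySub)

theorem Subst.maps_ident (S : Sig Op) (G : Ctx Op) : Subst.ident.Maps S G G where
  sk h := .var h
  ty {_ t} h := (t.subst_var).symm ▸ .var h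
  di h := .var h
  co {_ p} h := .var ((p.subst_ident).symm ▸ h)
  tm {_ T} h := .var ((T.subst_ident).symm ▸ h)

/-- First the substitution `s`, then the renaming `r`. -/
def Subst.thenRen (s : Subst Op) (r : Ren) : Subst Op :=
  ⟨s.toTySub.thenRen r.toTyRen, fun n => (s.co n).rename r.toTyRen r.co,
    fun n => (s.tm n).rename r⟩

/-- Here stability under substitution draws on stability under renaming: the images are renamed, and
their types follow by the composition laws. -/
theorem Subst.Maps.thenRen (hS : S.WF) {s : Subst Op} {r : Ren} {G G' G'' : Ctx Op}
    (hs : s.Maps S G G') (hr : r.Maps G' G'') : (s.thenRen r).Maps S G G'' where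
  sk h := (hs.sk h).rename hr
  ty {_ t} h := (t.subst_rename s.sk r.sk) ▸ (hs.ty h).rename hr
  di h := (hs.di h).rename hr
  co {_ p} h := (p.subst_rename s.toTySub r.toTyRen) ▸ (hs.co h).rename hr
  tm {_ T} h := (T.subst_rename s.toTySub r.toTyRen) ▸ (hs.tm h).rename hS hr

/-- `s` sends the variable declared by the entry `b` to an expression of the right type. -/
def Subst.MapsHead (S : Sig Op) (s : Subst Op) (G : Ctx Op) : Binding Op → Prop
  | .sk => WfSkel G (s.sk 0)
  | .ty t => WfVTy S G (s.ty 0) (t.subst s.sk)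
  | .di => WfDirt S G (s.di 0)
  | .co p => HasCo S G (s.co 0) (.simple (p.subst s.toTySub))
  | .tm T => HasVal S G (s.tm 0) (T.subst s.toTySub)

/-- The three equations say that `s'`, after weakening past `b`, agrees with `s`. So the older
variables keep their images and types, and only the new entry remains to be checked. Extension under
a binder and all the instantiations are obtained from this lemma. -/
theorem Subst.Maps.cons {s s' : Subst Op} {G G' : Ctx Op} {b : Binding Op} (hs : s.Maps S G G')
    (hty : b.wk.toTyRen.thenSub s'.toTySub = s.toTySub) (hco : ∀ n, s'.co (b.wk.co n) = s.co n)
    (htm : ∀ n, s'.tm (b.wk.tm n) = s.tm n) (hb : s'.MapsHead S G' b) :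
    s'.Maps S (b :: G) G' where
  sk h := by
    cases h with
    | here => exact hb
    | there b h =>
      have := hs.sk h
      rw [← hty] at this
      exact this
  ty h := by
    cases h with
    | here => exact hb
    | there b h =>
      have := hs.ty h
      rw [← hty] at this
      rw [Skel.rename_subst]
      exact this
  di h := by
    cases h with
    | here => exact hb
    | there b h =>
      have := hs.di h
      rw [← hty] at this
      exact this
  co h := by
    cases h with
    | here => exact hb
    | there b h =>
      rw [SCt.rename_subst, hty, hco]
      exact hs.co h
  tm h := by
    cases h with
    | here => exact hb
    | there b h =>
      rw [VTy.rename_subst, hty, htm]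
      exact hs.tm h

/-- Naturality of weakening for substitutions. The cases differ only in which components receive an
explicit identity renaming on the right and none on the left. -/
theorem Subst.wk_thenSub_up (s : Subst Op) (b : Binding Op) :
    b.wk.toTyRen.thenSub (s.up b).toTySub
      = s.toTySub.thenRen (b.subst s.toTySub).wk.toTyRen := by
  cases b with
  | tm T => exact s.toTySub.thenRen_ident.symm
  | co p => exact s.toTySub.thenRen_ident.symm
  | sk =>
    ext n
    · rfl
    · rfl
    · exact (Dirt.rename_id _).symm
  | ty t =>
    ext n
    · exact (Skel.rename_id _).symm
    · rfl
    · exact (Dirt.rename_id _).symm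
  | di =>
    ext n
    · exact (Skel.rename_id _).symm
    · rfl
    · rfl

/-- The substitution is first weakened into the larger target and then extended by the new variable,
which is sent to itself. -/
theorem Subst.Maps.up (hS : S.WF) {s : Subst Op} {G G' : Ctx Op} (hs : s.Maps S G G')
    (b : Binding Op) : (s.up b).Maps S (b :: G) (b.subst s.toTySub :: G') := by
  refine (hs.thenRen hS (Ren.maps_wk (b.subst s.toTySub) G')).cons (s.wk_thenSub_up b) ?_ ?_ ?_
  · intro n
    cases b with
    -- `upTm` leaves the coercion images alone, whereas the weakened substitution renames them by
    -- the identity.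
    | tm T => exact (Co.rename_ident _).symm
    | _ => rfl
  · intro n
    cases b <;> rfl
  · cases b with
    | sk => exact .var .here
    | ty t => exact .var .here
    | di => exact .var .here
    | tm T => exact .var .here
    | co p => exact .var .here

theorem Subst.maps_instSk {G : Ctx Op} {t : Skel} (ht : WfSkel G t) :
    (Subst.instSk t).Maps S (.sk :: G) G :=
  (Subst.maps_ident S G).cons rfl (fun _ => rfl) (fun _ => rfl) ht

theorem Subst.maps_instTy {G : Ctx Op} {T : VTy Op} {t : Skel} (hT : WfVTy S G T t) :
    (Subst.instTy T).Maps S (.ty t :: G) G :=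
  (Subst.maps_ident S G).cons rfl (fun _ => rfl) (fun _ => rfl)
    (show WfVTy S G T (t.subst Skel.var) by rwa [t.subst_var])

theorem Subst.maps_instDi {G : Ctx Op} {D : Dirt Op} (hD : WfDirt S G D) :
    (Subst.instDi D).Maps S (.di :: G) G :=
  (Subst.maps_ident S G).cons rfl (fun _ => rfl) (fun _ => rfl) hD

theorem Subst.maps_instCo {G : Ctx Op} {g : Co Op} {p : SCt Op} (hg : HasCo S G g (.simple p)) :
    (Subst.instCo g).Maps S (.co p :: G) G :=
  (Subst.maps_ident S G).cons rfl (fun _ => rfl) (fun _ => rfl)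
    (show HasCo S G g (.simple (p.subst TySub.ident)) by rwa [p.subst_ident])

theorem Subst.maps_instTm {G : Ctx Op} {v : Val Op} {T : VTy Op} (hv : HasVal S G v T) :
    (Subst.instTm v).Maps S (.tm T :: G) G :=
  (Subst.maps_ident S G).cons rfl (fun _ => rfl) (fun _ => rfl)
    (show HasVal S G v (T.subst TySub.ident) by rwa [T.subst_ident])

/-- The argument `x` is added to the identity first, the continuation `k` second. Types do not
depend on term variables, so `U` needs no weakening past `x`. -/
theorem Subst.maps_instTm2 {G : Ctx Op} {v w : Val Op} {T U : VTy Op} (hv : HasVal S G v T)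
    (hw : HasVal S G w U) : (Subst.instTm2 v w).Maps S (.tm U :: .tm T :: G) G :=
  (Subst.maps_instTm hv).cons rfl (fun _ => rfl) (fun _ => rfl)
    (show HasVal S G w (U.subst TySub.ident) by rwa [U.subst_ident])

/-! ### Typing is stable under substitution -/

mutual
-- This is what substitution in `⟨α⟩` requires. Well-formedness supplies the premises for the
-- variables, dirts and qualifiers met in the recursion.
theorem WfVTy.hasCo_reflCo {G : Ctx Op} {T : VTy Op} {t : Skel} :
    WfVTy S G T t → HasCo S G T.reflCo (.simple (.vle T T))
  | .var h => .tyRefl (.var h)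
  | .unit => .unitRefl
  | .arr h1 h2 => .arr h1.hasCo_reflCo h2.hasCo_reflCo
  | .hnd h1 h2 => .hnd h1.hasCo_reflCo h2.hasCo_reflCo
  | .qual h1 h2 => .qual h2.hasCo_reflCo h1
  | .allSk h => .allSk h.hasCo_reflCo
  | .allTy h => .allTy h.hasCo_reflCo
  | .allDi h => .allDi h.hasCo_reflCo
theorem WfCTy.hasCo_reflCo {G : Ctx Op} {C : CTy Op} {t : Skel} :
    WfCTy S G C t → HasCo S G C.reflCo (.cle C C)
  | .mk h1 h2 => .comp h1.hasCo_reflCo (.diRefl h2)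
end

theorem WfSkel.subst (hS : S.WF) {G : Ctx Op} {t : Skel} (h : WfSkel G t) :
    ∀ {s : Subst Op} {G' : Ctx Op}, s.Maps S G G' → WfSkel G' (t.subst s.sk) := by
  induction h with
  | var h => exact fun hs => hs.sk h
  | unit => exact fun _ => .unit
  | arr _ _ ih1 ih2 => exact fun hs => .arr (ih1 hs) (ih2 hs)
  | hnd _ _ ih1 ih2 => exact fun hs => .hnd (ih1 hs) (ih2 hs)
  | all _ ih => exact fun hs => .all (ih (hs.up hS .sk))

theorem WfDirt.subst {G : Ctx Op} {D : Dirt Op} (h : WfDirt S G D) {s : Subst Op} {G' : Ctx Op}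
    (hs : s.Maps S G G') : WfDirt S G' (D.subst s.di) := by
  induction h with
  | nil => exact .nil
  | var h =>
    rw [Dirt.var_subst]
    exact hs.di h
  | cons hS _ ih =>
    rw [Dirt.cons_subst]
    exact .cons hS ih

mutual
theorem WfVTy.subst (hS : S.WF) {G : Ctx Op} {T : VTy Op} {t : Skel} {s : Subst Op}
    {G' : Ctx Op} (hs : s.Maps S G G') :
    WfVTy S G T t → WfVTy S G' (T.subst s.toTySub) (t.subst s.sk)
  | .var h => hs.ty h
  | .unit => .unit
  | .arr h1 h2 => .arr (h1.subst hS hs) (h2.subst hS hs)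
  | .hnd h1 h2 => .hnd (h1.subst hS hs) (h2.subst hS hs)
  | .qual h1 h2 => .qual (h1.subst hS hs) (h2.subst hS hs)
  | .allSk h => .allSk (h.subst hS (hs.up hS .sk))
  | .allTy h => .allTy (h.subst hS (hs.up hS (.ty _)))
  | .allDi h => .allDi (h.subst hS (hs.up hS .di))
theorem WfCTy.subst (hS : S.WF) {G : Ctx Op} {C : CTy Op} {t : Skel} {s : Subst Op}
    {G' : Ctx Op} (hs : s.Maps S G G') :
    WfCTy S G C t → WfCTy S G' (C.subst s.toTySub) (t.subst s.sk)
  | .mk h1 h2 => .mk (h1.subst hS hs) (h2.subst hs)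
theorem WfSCt.subst (hS : S.WF) {G : Ctx Op} {p : SCt Op} {s : Subst Op} {G' : Ctx Op}
    (hs : s.Maps S G G') : WfSCt S G p → WfSCt S G' (p.subst s.toTySub)
  | .vle h1 h2 => .vle (h1.subst hS hs) (h2.subst hS hs)
  | .dle h1 h2 => .dle (h1.subst hs) (h2.subst hs)
end

theorem HasCo.subst (hS : S.WF) {G : Ctx Op} {g : Co Op} {q : FCt Op} (h : HasCo S G g q) :
    ∀ {s : Subst Op} {G' : Ctx Op}, s.Maps S G G' →
      HasCo S G' (g.subst s.toTySub s.co) (q.subst s.toTySub) := by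
  induction h with
  | var h => exact fun hs => hs.co h
  | tyRefl h => exact fun hs => (h.subst hS hs).hasCo_reflCo
  | diRefl h => exact fun hs => .diRefl (h.subst hs)
  | unitRefl => exact fun _ => .unitRefl
  | arr _ _ ih1 ih2 => exact fun hs => .arr (ih1 hs) (ih2 hs)
  | hnd _ _ ih1 ih2 => exact fun hs => .hnd (ih1 hs) (ih2 hs)
  | allSk _ ih => exact fun hs => .allSk (ih (hs.up hS .sk))
  | allTy _ ih => exact fun hs => .allTy (ih (hs.up hS (.ty _)))
  | allDi _ ih => exact fun hs => .allDi (ih (hs.up hS .di))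
  | qual _ h ih => exact fun hs => .qual (ih hs) (h.subst hS hs)
  | empty h => exact fun hs => .empty (h.subst hs)
  | comp _ _ ih1 ih2 => exact fun hs => .comp (ih1 hs) (ih2 hs)
  | insert _ ho ih =>
    intro s G' hs
    simp only [FCt.subst, SCt.subst, Dirt.cons_subst]
    exact .insert (ih hs) ho

/-- Replacing the tail variable can only add operations, so the side condition of an operation call
survives. -/
theorem Dirt.mem_ops_subst {o : Op} {D : Dirt Op} (h : o ∈ D.ops) (s : ℕ → Dirt Op) :
    o ∈ (D.subst s).ops := by
  rcases D with ⟨O, _ | n⟩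
  · exact h
  · exact Finset.mem_union_right _ h

mutual
theorem HasVal.subst (hS : S.WF) {G : Ctx Op} {v : Val Op} {T : VTy Op} {s : Subst Op}
    {G' : Ctx Op} (hs : s.Maps S G G') :
    HasVal S G v T → HasVal S G' (v.subst s) (T.subst s.toTySub)
  | .var h => hs.tm h
  | .unit => .unit
  | .lam h hT => .lam (h.subst hS (hs.up hS (.tm _))) (hT.subst hS hs)
  | .cast h hg => .cast (h.subst hS hs) (hg.subst hS hs)
  | .skLam h => .skLam (h.subst hS (hs.up hS .sk))
  | .tyLam h => .tyLam (h.subst hS (hs.up hS (.ty _)))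
  | .diLam h => .diLam (h.subst hS (hs.up hS .di))
  | .coLam h hp => .coLam (h.subst hS (hs.up hS (.co _))) (hp.subst hS hs)
  | .coApp h hg => .coApp (h.subst hS hs) (hg.subst hS hs)
  | .hand (h := cl) hc hn hcl => by
    have hn' : (cl.subst s).opList.Nodup := (Clauses.opList_subst s cl).symm ▸ hn
    have hcl' := hcl.subst hS hs
    have := HasVal.hand (h := cl.subst s) (T := VTy.subst s.toTySub _)
      (D := Dirt.subst s.di _) (hc.subst hS (hs.up hS (.tm _))) hn' hcl'
    -- Adding the handled operations commutes with substitution in the dirt; for renamings this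
    -- holds by definition.
    simp only [VTy.subst, CTy.subst, Dirt.addOps_subst]
    rw [Clauses.opList_subst] at this
    exact this
  | .skApp h ht => by
    rw [VTy.instSk_subst]
    exact .skApp (h.subst hS hs) (ht.subst hS hs)
  | .tyApp h ht => by
    rw [VTy.instTy_subst]
    exact .tyApp (h.subst hS hs) (ht.subst hS hs)
  | .diApp h ht => by
    rw [VTy.instDi_subst]
    exact .diApp (h.subst hS hs) (ht.subst hs)
theorem HasComp.subst (hS : S.WF) {G : Ctx Op} {c : Comp Op} {C : CTy Op} {s : Subst Op}
    {G' : Ctx Op} (hs : s.Maps S G G') :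
    HasComp S G c C → HasComp S G' (c.subst s) (C.subst s.toTySub)
  | .app h1 h2 => .app (h1.subst hS hs) (h2.subst hS hs)
  | .letv h1 h2 => .letv (h1.subst hS hs) (h2.subst hS (hs.up hS (.tm _)))
  | .ret h => .ret (h.subst hS hs)
  | .bind h1 h2 => .bind (h1.subst hS hs) (h2.subst hS (hs.up hS (.tm _)))
  | .op (A := A) (B := B) ho hv hc hD => by
    have hv' := hv.subst hS hs
    have hc' := hc.subst hS (hs.up hS (.tm _))
    simp only [Binding.subst, (hS _ _ _ ho).1.1.subst, (hS _ _ _ ho).2.1.subst] at hv' hc'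
    simp only [Comp.subst, (hS _ _ _ ho).2.1.subst]
    exact .op ho hv' hc' (Dirt.mem_ops_subst hD _)
  | .handle h1 h2 => .handle (h1.subst hS hs) (h2.subst hS hs)
  | .cast h hg => .cast (h.subst hS hs) (hg.subst hS hs)
theorem HasClauses.subst (hS : S.WF) {G : Ctx Op} {h : Clauses Op} {T : VTy Op} {D : Dirt Op}
    {s : Subst Op} {G' : Ctx Op} (hs : s.Maps S G G') :
    HasClauses S G h T D → HasClauses S G' (h.subst s) (T.subst s.toTySub) (D.subst s.di)
  | .nil => .nil
  | .cons ho hc hcl => by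
    have hc' := hc.subst hS ((hs.up hS (.tm _)).up hS (.tm _))
    simp only [Binding.subst, VTy.subst, Subst.up, Subst.upTm, (hS _ _ _ ho).1.1.subst,
      (hS _ _ _ ho).2.1.subst] at hc'
    exact .cons ho hc' (hcl.subst hS hs)
end

end

end

section
variable {Op : Type u}

-- Variables of an environment and the shape of terminal computations

theorem LookTm.mem {G : Ctx Op} {n : ℕ} {T : VTy Op} (h : LookTm G n T) :
    ∃ U : VTy Op, Binding.tm U ∈ G := by
  induction h with
  | here => exact ⟨_, List.mem_cons_self ..⟩
  | there b _ ih => exact ih.imp fun _ h => List.mem_cons_of_mem _ h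

theorem LookCo.mem {G : Ctx Op} {n : ℕ} {p : SCt Op} (h : LookCo G n p) :
    ∃ q : SCt Op, Binding.co q ∈ G := by
  induction h with
  | here => exact ⟨_, List.mem_cons_self ..⟩
  | there b _ ih => exact ih.imp fun _ h => List.mem_cons_of_mem _ h

theorem Ctx.TypeLevel.noDirtCo {G : Ctx Op} (hG : G.TypeLevel) : G.NoDirtCo :=
  fun _ _ => hG.2 _

/-- Passes from the inductive form of terminal computations to the list form used by `doRet` and
`handleRet`. The outermost cast is the last entry of the list. -/
theorem TermComp.eq_retCasts {c : Comp Op} (h : TermComp c) :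
    ∃ (v : Val Op) (l : List (Co Op × Co Op)), ResVal v ∧ c = retCasts v l := by
  induction h with
  | ret hv => exact ⟨_, [], hv, rfl⟩
  | cast g1 g2 _ ih =>
    obtain ⟨v, l, hv, rfl⟩ := ih
    exact ⟨v, l ++ [(g1, g2)], hv, by simp [retCasts]⟩

section
variable [DecidableEq Op] {S : Sig Op}

/-! ### Preservation -/

theorem StepVal.preservation (hS : S.WF) {G : Ctx Op} {v v' : Val Op} (h : StepVal v v') :
    ∀ {T : VTy Op}, HasVal S G v T → HasVal S G v' T := by
  induction h with
  | cast g _ ih =>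
    rintro _ (_ | _ | _ | ⟨hv, hg⟩)
    exact .cast (ih hv) hg
  | pushUnit _ =>
    intro _ h
    cases h with
    | cast hv hg => cases hg; exact hv
  | skApp t _ ih => intro _ h; cases h with | skApp hv ht => exact .skApp (ih hv) ht
  | tyApp T _ ih => intro _ h; cases h with | tyApp hv ht => exact .tyApp (ih hv) ht
  | diApp D _ ih => intro _ h; cases h with | diApp hv ht => exact .diApp (ih hv) ht
  | coApp g _ ih => intro _ h; cases h with | coApp hv ht => exact .coApp (ih hv) ht
  | pushSkel g t _ =>
    intro _ h
    cases h with
    | skApp h ht =>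
      cases h with
      | cast hv hg =>
        cases hg with
        | allSk hg => exact .cast (.skApp hv ht) (hg.subst hS (Subst.maps_instSk ht))
  | pushTy t g T _ =>
    intro _ h
    cases h with
    | tyApp h ht =>
      cases h with
      | cast hv hg =>
        cases hg with
        | allTy hg => exact .cast (.tyApp hv ht) (hg.subst hS (Subst.maps_instTy ht))
  | pushDirt g D _ =>
    intro _ h
    cases h with
    | diApp h ht =>
      cases h with
      | cast hv hg =>
        cases hg with
        | allDi hg => exact .cast (.diApp hv ht) (hg.subst hS (Subst.maps_instDi ht))
  | pushQual p g1 g2 _ =>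
    intro _ h
    cases h with
    | coApp h hg2 =>
      cases h with
      | cast hv hg =>
        cases hg with
        | qual hg1 hp => exact .cast (.coApp hv hg2) hg1
  | betaSkel v t =>
    intro _ h
    cases h with
    | skApp h ht => cases h with | skLam hv => exact hv.subst hS (Subst.maps_instSk ht)
  | betaTy t v T =>
    intro _ h
    cases h with
    | tyApp h ht => cases h with | tyLam hv => exact hv.subst hS (Subst.maps_instTy ht)
  | betaDirt v D =>
    intro _ h
    cases h with
    | diApp h ht => cases h with | diLam hv => exact hv.subst hS (Subst.maps_instDi ht)
  | betaCo p v g =>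
    intro T h
    cases h with
    | coApp h hg =>
      cases h with
      | coLam hv hp =>
        -- Types contain no coercion variables, so instantiating `ω` leaves `T` unchanged.
        rw [← T.subst_ident]
        exact hv.subst hS (Subst.maps_instCo hg)

-- Ingredients of preservation for computations

theorem HasComp.instTm (hS : S.WF) {G : Ctx Op} {v : Val Op} {c : Comp Op} {T : VTy Op}
    {C : CTy Op} (hc : HasComp S (.tm T :: G) c C) (hv : HasVal S G v T) :
    HasComp S G (c.subst (.instTm v)) C := by
  rw [← C.subst_ident]
  exact hc.subst hS (Subst.maps_instTm hv)

/-- Apart from variables, a coercion between dirts is built from reflexivity, `∅ ≤ Δ` and the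
addition of one operation to both sides, and each of these gives an inclusion. -/
theorem HasCo.ops_subset {G : Ctx Op} (hG : G.NoDirtCo) {g : Co Op} {q : FCt Op}
    (h : HasCo S G g q) :
    ∀ {D1 D2 : Dirt Op}, q = .simple (.dle D1 D2) → D1.ops ⊆ D2.ops := by
  -- Weakening preserves the form of a coercion type, so a variable of type `Δ₁ ≤ Δ₂` must come from
  -- a declaration of that form.
  have look : ∀ {G : Ctx Op} {n : ℕ} {p : SCt Op}, LookCo G n p → G.NoDirtCo →
      ∀ D1 D2 : Dirt Op, p ≠ .dle D1 D2 := by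
    intro G n p h
    induction h with
    | here => rintro hG D1 D2 rfl; exact hG D1 D2 (List.mem_cons_self ..)
    | @there G n p b _ ih =>
      intro hG D1 D2 hp
      cases p with
      | vle T1 T2 => simp [SCt.rename] at hp
      | dle E1 E2 => exact ih (fun _ _ hm => hG _ _ (List.mem_cons_of_mem _ hm)) E1 E2 rfl
  induction h with
  | var h => intro D1 D2 hq; cases hq; exact absurd rfl (look h hG D1 D2)
  | diRefl _ => intro D1 D2 hq; cases hq; exact subset_rfl
  | empty _ => intro D1 D2 hq; cases hq; exact Finset.empty_subset _
  | insert _ _ ih => intro D1 D2 hq; cases hq; exact Finset.insert_subset_insert _ (ih hG rfl)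
  -- The remaining constructors relate value or computation types, not dirts.
  | _ => intro D1 D2 hq; cases hq

/-- Each cast by `γ₁ ! γ₂` splits into a cast of the value by `γ₁` and a change of dirt that the
value ignores. The induction removes the outermost cast; type and dirt vary along the chain and are
therefore generalized. -/
theorem HasComp.valCasts {G : Ctx Op} {v : Val Op} {T : VTy Op} {D : Dirt Op}
    (l : List (Co Op × Co Op)) (h : HasComp S G (retCasts v l) (.mk T D)) :
    HasVal S G (valCasts v l) T := by
  induction l using List.reverseRecOn generalizing T D with
  | nil => cases h; assumption
  | append_singleton l g ih =>
    simp only [retCasts, ExEff.valCasts, List.foldl_append, List.foldl_cons, List.foldl_nil] at h ih ⊢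
    cases h with
    | cast hc hg =>
      cases hg with
      | comp hg1 hg2 => exact .cast (ih hc) hg1

theorem HasClauses.of_lookup {G : Ctx Op} {h : Clauses Op} {T : VTy Op} {D : Dirt Op} {o : Op}
    {c : Comp Op} (hcl : HasClauses S G h T D) (hc : h.lookup o = some c) :
    ∃ A B : VTy Op, S o = some (A, B) ∧
      HasComp S (.tm (.arr B (.mk T D)) :: .tm A :: G) c (.mk T D) :=
  match hcl with
  | .nil => by simp [Clauses.lookup] at hc
  | .cons (o := o') ho hc' hcl => by
    by_cases he : o' = o
    · simp only [Clauses.lookup, he, if_true, Option.some.injEq] at hc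
      subst he hc
      exact ⟨_, _, ho, hc'⟩
    · simp only [Clauses.lookup, he, if_false] at hc
      exact hcl.of_lookup hc

theorem Clauses.not_mem_opList {o : Op} : ∀ {h : Clauses Op}, h.lookup o = none → o ∉ h.opList
  | .nil, _ => by simp [Clauses.opList]
  | .cons o' c h, hn => by
    by_cases he : o' = o
    · simp [Clauses.lookup, he] at hn
    · simp only [Clauses.lookup, he, if_false] at hn
      simpa [Clauses.opList, Ne.symm he] using Clauses.not_mem_opList hn

theorem HasVal.weakenTm (hS : S.WF) {G : Ctx Op} {v : Val Op} {T : VTy Op}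
    (h : HasVal S G v T) (U : VTy Op) : HasVal S (.tm U :: G) (v.rename Ren.wkTm) T := by
  rw [← T.rename_ident]
  exact h.rename hS (Ren.maps_wk (.tm U) G)

/-- For `doOp`: the body of the `do` moves under the binder of the continuation, so the new variable
is inserted beneath the one bound by the `do`. -/
theorem HasComp.weakenTm_up (hS : S.WF) {G : Ctx Op} {c : Comp Op} {T : VTy Op} {C : CTy Op}
    (h : HasComp S (.tm T :: G) c C) (U : VTy Op) :
    HasComp S (.tm T :: .tm U :: G) (c.rename Ren.wkTm.upTm) C := by
  have := h.rename hS ((Ren.maps_wk (.tm U) G).up (.tm T))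
  have hT : Binding.rename (Binding.wk (.tm U)).toTyRen (.tm T) = .tm T :=
    congrArg Binding.tm T.rename_ident
  rw [hT] at this
  rw [← C.rename_ident]
  exact this

/-- The identity renaming maps the empty environment to any other, vacuously. This supplies the
well-formedness of the annotation on the continuation built by `handleOp1`. -/
theorem WfVTy.of_nil {T : VTy Op} {t : Skel} (h : WfVTy S [] T t) (G : Ctx Op) :
    WfVTy S G T t := by
  rw [← T.rename_ident, ← t.rename_id]
  exact h.rename (r := Ren.ident)
    { sk := by rintro _ ⟨⟩
      ty := by rintro _ _ ⟨⟩
      di := by rintro _ ⟨⟩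
      co := by rintro _ _ ⟨⟩
      tm := by rintro _ _ ⟨⟩ }

theorem StepComp.preservation (hS : S.WF) {G : Ctx Op} (hG : G.NoDirtCo) {c c' : Comp Op}
    (h : StepComp c c') : ∀ {C : CTy Op}, HasComp S G c C → HasComp S G c' C := by
  induction h with
  | cast g _ ih => intro _ h; cases h with | cast hc hg => exact .cast (ih hc) hg
  | appFun v2 hs =>
    intro _ h; cases h with | app h1 h2 => exact .app (hs.preservation hS h1) h2
  | pushApp g1 g2 v2 _ =>
    intro _ h
    cases h with
    | app h1 h2 =>
      cases h1 with
      | cast hv hg => cases hg with | arr hg1 hg2 => exact .cast (.app hv (.cast h2 hg1)) hg2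
  | appArg _ hs => intro _ h; cases h with | app h1 h2 => exact .app h1 (hs.preservation hS h2)
  | beta T c _ =>
    intro _ h
    cases h with
    | app h1 h2 => cases h1 with | lam hc _ => exact hc.instTm hS h2
  | letStep c hs => intro _ h; cases h with | letv h1 h2 => exact .letv (hs.preservation hS h1) h2
  | letVal c _ => intro _ h; cases h with | letv h1 h2 => exact h2.instTm hS h1
  | ret hs => intro _ h; cases h with | ret h => exact .ret (hs.preservation hS h)
  | op o T c hs =>
    intro _ h
    cases h with | op ho hv hc hD => exact .op ho (hs.preservation hS hv) hc hD
  | pushOp o T c g _ =>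
    intro _ h
    cases h with
    | cast h hg =>
      cases hg with
      | comp hg1 hg2 =>
        cases h with
        | op ho hv hc hD =>
          -- The coercion enters the continuation under one more term variable, and its dirt part
          -- keeps the operation in the target dirt. This is the only step that uses the assumption
          -- on dirt coercion variables.
          exact .op ho hv (.cast hc ((HasCo.comp hg1 hg2).weakenTm _))
            (hg2.ops_subset hG rfl hD)
  | bind c2 _ ih => intro _ h; cases h with | bind h1 h2 => exact .bind (ih h1) h2
  | doRet l c2 _ => intro _ h; cases h with | bind h1 h2 => exact h2.instTm hS (h1.valCasts l)
  | doOp o T c1 c2 _ =>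
    intro _ h
    cases h with
    | bind h1 h2 =>
      cases h1 with
      | op ho hv hc hD => exact .op ho hv (.bind hc (h2.weakenTm_up hS _)) hD
  | handleFun c hs =>
    intro _ h; cases h with | handle h1 h2 => exact .handle (hs.preservation hS h1) h2
  | pushHandle g1 g2 c _ =>
    intro _ h
    cases h with
    | handle h1 h2 =>
      cases h1 with
      | cast hv hg => cases hg with | hnd hg1 hg2 => exact .cast (.handle hv (.cast h2 hg1)) hg2
  | handleArg _ _ ih => intro _ h; cases h with | handle h1 h2 => exact .handle h1 (ih h2)
  | handleRet T cr h l _ =>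
    intro _ h
    cases h with
    | handle h1 h2 => cases h1 with | hand hc hn hcl => exact hc.instTm hS (h2.valCasts l)
  | handleOp1 T cr h o U c co _ hl =>
    intro _ h
    cases h with
    | handle h1 h2 =>
      have hh := h1
      cases h1 with
      | @hand _ _ Tr _ _ Dr hc hn hcl =>
        cases h2 with
        | op ho hv hk hD =>
          obtain ⟨A, B, ho', hco⟩ := hcl.of_lookup hl
          -- The call and the clause take the types of the operation from the same signature, so
          -- these coincide.
          cases ho.symm.trans ho'
          obtain ⟨t, hB⟩ := (hS _ _ _ ho).2.2
          rw [← (CTy.mk Tr Dr).subst_ident]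
          -- The continuation keeps the whole handler around the rest of the computation, so its
          -- codomain is the handler's output type, as the clause expects of `k`.
          exact hco.subst hS (Subst.maps_instTm2 hv
            (.lam (.handle (hh.weakenTm hS _) hk) (hB.of_nil G)))
  | handleOp2 T cr h o U c _ hl =>
    intro _ h
    cases h with
    | handle h1 h2 =>
      have hh := h1
      cases h1 with
      | hand hc hn hcl =>
        cases h2 with
        | op ho hv hk hD =>
          refine .op ho hv (.handle (hh.weakenTm hS _) hk) ?_
          -- The operation lies in `Δ ∪ O` but has no clause, so it lies in `Δ`.
          simpa [Dirt.addOps, Clauses.not_mem_opList hl] using hD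

/-! ### Progress -/

/-- A terminal value has a type with a proper head constructor, and the coercions allowed on results
have targets of that kind too. Hence a well-typed cast by `⟨α⟩` never sits on a result. -/
theorem ResVal.not_hasVal_var {G : Ctx Op} {v : Val Op} {n : ℕ} (hv : ResVal v) :
    ¬ HasVal S G v (.var n) := by
  intro h
  cases hv with
  | term hv => cases hv <;> cases h
  | _ => cases h with | cast _ hg => cases hg

theorem HasVal.progress {G : Ctx Op} (hG : G.TypeLevel) {v : Val Op} {T : VTy Op}
    (h : HasVal S G v T) : ResVal v ∨ ∃ v' : Val Op, StepVal v v' :=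
  match h with
  | .var h => absurd h.mem.choose_spec (hG.1 _)
  | .unit => .inl (.term .unit)
  | .lam _ _ => .inl (.term (.lam _ _))
  | .skLam _ => .inl (.term (.skLam _))
  | .tyLam _ => .inl (.term (.tyLam _ _))
  | .diLam _ => .inl (.term (.diLam _))
  | .coLam _ _ => .inl (.term (.coLam _ _))
  | .hand _ _ _ => .inl (.term (.hand _ _ _))
  | .cast hv hg => by
    rcases hv.progress hG with hr | ⟨v', hs⟩
    · cases hg with
      | var h => exact absurd h.mem.choose_spec (hG.2 _)
      | tyRefl _ => exact absurd hv hr.not_hasVal_var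
      | unitRefl => exact .inr ⟨_, .pushUnit hr⟩
      | arr _ _ => exact .inl (.arr _ _ hr)
      | hnd _ _ => exact .inl (.hnd _ _ hr)
      | allSk _ => exact .inl (.allSk _ hr)
      | allTy _ => exact .inl (.allTy _ _ hr)
      | allDi _ => exact .inl (.allDi _ hr)
      | qual _ _ => exact .inl (.qual _ _ hr)
    · exact .inr ⟨_, .cast _ hs⟩
  | .skApp hv _ => by
    rcases hv.progress hG with hr | ⟨v', hs⟩
    · right
      cases hr with
      -- Typing excludes every terminal value except the skeleton abstraction.
      | term hr => cases hr <;> cases hv; exact ⟨_, .betaSkel _ _⟩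
      | allSk g hr => exact ⟨_, .pushSkel _ _ hr⟩
      -- A result cast by any other coercion form has a target that is not of the form `∀ς. T`.
      | _ => cases hv with | cast _ hg => cases hg
    · exact .inr ⟨_, .skApp _ hs⟩
  | .tyApp hv _ => by
    rcases hv.progress hG with hr | ⟨v', hs⟩
    · right
      cases hr with
      | term hr => cases hr <;> cases hv; exact ⟨_, .betaTy _ _ _⟩
      | allTy t g hr => exact ⟨_, .pushTy _ _ _ hr⟩
      | _ => cases hv with | cast _ hg => cases hg
    · exact .inr ⟨_, .tyApp _ hs⟩
  | .diApp hv _ => by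
    rcases hv.progress hG with hr | ⟨v', hs⟩
    · right
      cases hr with
      | term hr => cases hr <;> cases hv; exact ⟨_, .betaDirt _ _⟩
      | allDi g hr => exact ⟨_, .pushDirt _ _ hr⟩
      | _ => cases hv with | cast _ hg => cases hg
    · exact .inr ⟨_, .diApp _ hs⟩
  | .coApp hv _ => by
    rcases hv.progress hG with hr | ⟨v', hs⟩
    · right
      cases hr with
      | term hr => cases hr <;> cases hv; exact ⟨_, .betaCo _ _ _⟩
      | qual p g hr => exact ⟨_, .pushQual _ _ _ hr⟩
      | _ => cases hv with | cast _ hg => cases hg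
    · exact .inr ⟨_, .coApp _ hs⟩

theorem HasComp.progress {G : Ctx Op} (hG : G.TypeLevel) {c : Comp Op} {C : CTy Op}
    (h : HasComp S G c C) : ResComp c ∨ ∃ c' : Comp Op, StepComp c c' :=
  match h with
  | .app hv1 hv2 => by
    right
    rcases hv1.progress hG with hr | ⟨v', hs⟩
    · cases hr with
      | term hr =>
        cases hr <;> cases hv1
        rcases hv2.progress hG with hr2 | ⟨v', hs⟩
        · exact ⟨_, .beta _ _ hr2⟩
        · exact ⟨_, .appArg (.lam _ _) hs⟩
      -- The push applies to any argument; evaluation of the argument begins only once the head is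
      -- terminal.
      | arr g1 g2 hr => exact ⟨_, .pushApp _ _ _ hr⟩
      | _ => cases hv1 with | cast _ hg => cases hg
    · exact ⟨_, .appFun _ hs⟩
  | .letv hv _ => by
    rcases hv.progress hG with hr | ⟨v', hs⟩
    · exact .inr ⟨_, .letVal _ hr⟩
    · exact .inr ⟨_, .letStep _ hs⟩
  | .ret hv => by
    rcases hv.progress hG with hr | ⟨v', hs⟩
    · exact .inl (.term (.ret hr))
    · exact .inr ⟨_, .ret hs⟩
  | .bind h1 _ => by
    right
    rcases h1.progress hG with hr | ⟨c', hs⟩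
    · cases hr with
      | term hr =>
        obtain ⟨v, l, hv, rfl⟩ := hr.eq_retCasts
        exact ⟨_, .doRet l _ hv⟩
      | op o T c hv => exact ⟨_, .doOp _ _ _ _ hv⟩
    · exact ⟨_, .bind _ hs⟩
  | .op _ hv _ _ => by
    rcases hv.progress hG with hr | ⟨v', hs⟩
    · exact .inl (.op _ _ _ hr)
    · exact .inr ⟨_, .op _ _ _ hs⟩
  | .handle hv hc => by
    right
    rcases hv.progress hG with hr | ⟨v', hs⟩
    · cases hr with
      | term hr =>
        cases hr <;> cases hv
        rcases hc.progress hG with hr | ⟨c', hs⟩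
        · cases hr with
          | term hr =>
            obtain ⟨v, l, hv, rfl⟩ := hr.eq_retCasts
            exact ⟨_, .handleRet _ _ _ l hv⟩
          | op o T c hv =>
            rcases hl : Clauses.lookup _ o with _ | co
            · exact ⟨_, .handleOp2 _ _ _ _ _ _ hv hl⟩
            · exact ⟨_, .handleOp1 _ _ _ _ _ _ _ hv hl⟩
        · exact ⟨_, .handleArg (.hand _ _ _) hs⟩
      | hnd g1 g2 hr => exact ⟨_, .pushHandle _ _ _ hr⟩
      | _ => cases hv with | cast _ hg => cases hg
    · exact ⟨_, .handleFun _ hs⟩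
  | .cast hc hg => by
    rcases hc.progress hG with hr | ⟨c', hs⟩
    · cases hr with
      -- No coercion variable has a type `C₁ ≤ C₂`, so the coercion must be of the form `γ₁ ! γ₂`.
      | term hr => cases hg; exact .inl (.term (.cast _ _ hr))
      | op o T c hv => exact .inr ⟨_, .pushOp _ _ _ _ hv⟩
    · exact .inr ⟨_, .cast _ hs⟩

end

end

end ExEff

-- Type safety

open ExEff in
theorem theorem4p2 {Op : Type*} [DecidableEq Op] (S : Sig Op) (hS : S.WF) (G : Ctx Op) :
    (∀ (v : Val Op) (T : VTy Op), HasVal S G v T →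
      (G.TypeLevel → ResVal v ∨ ∃ v' : Val Op, StepVal v v' ∧ HasVal S G v' T) ∧
      (∀ v' : Val Op, StepVal v v' → HasVal S G v' T)) ∧
    (∀ (c : Comp Op) (C : CTy Op), HasComp S G c C →
      (G.TypeLevel → ResComp c ∨ ∃ c' : Comp Op, StepComp c c' ∧ HasComp S G c' C) ∧
      (G.NoDirtCo → ∀ c' : Comp Op, StepComp c c' → HasComp S G c' C)) := by
  refine ⟨fun v T h => ⟨fun hG => ?_, fun v' hs => hs.preservation hS h⟩,
    fun c C h => ⟨fun hG => ?_, fun hG c' hs => hs.preservation hS hG h⟩⟩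
  · exact (h.progress hG).imp_right fun ⟨v', hs⟩ => ⟨v', hs, hs.preservation hS h⟩
  · exact (h.progress hG).imp_right fun ⟨c', hs⟩ => ⟨c', hs, hs.preservation hS hG.noDirtCo h⟩
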